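/- For integers $t\ge 0$ and $n\ge 1$, call a (finite simple) graph $G$ on $n$ vertices extremal if every vertex of $G$ is contained in at least $\binom{t}{2}$ triangles of $G$ and $G$ has the minimum number of edges among all graphs on $n$ vertices with this property. Let $c = 1+\sqrt{928/33}$. There exist a function $f:\mathbb{N}\to\mathbb{R}$ with $f(t)=o(t^2)$ as $t\to\infty$ and an integer $T$ such that for all integers $t\ge T$ and all integers $n\ge ct^2+f(t)$, every extremal graph $G$ on $n$ vertices contains an isolated copy of $K_{t+1}$, that is, a set of $t+1$ pairwise adjacent vertices of $G$ none of which is adjacent to a vertex outside the set. -/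

import Mathlib

open Filter Asymptotics

namespace MinDegKruskalKatona

/-- The number of triangles of `G` (three-element cliques) that contain the vertex `v`. -/
noncomputable def triangleDegree {V : Type*} (G : SimpleGraph V) (v : V) : ℕ :=
  {s : Finset V | G.IsNClique 3 s ∧ v ∈ s}.ncard

/-- Every vertex of `G` lies in at least `t.choose 2` triangles. -/
def TriangleCondition {V : Type*} (G : SimpleGraph V) (t : ℕ) : Prop :=
  ∀ v : V, t.choose 2 ≤ triangleDegree G v

/-- `G` has the minimum number of edges among all graphs on its (finite) vertex set in which
every vertex lies in at least `t.choose 2` triangles. -/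
def IsExtremal {V : Type*} [Fintype V] (G : SimpleGraph V) (t : ℕ) : Prop :=
  TriangleCondition G t ∧
    ∀ H : SimpleGraph V, TriangleCondition H t → G.edgeSet.ncard ≤ H.edgeSet.ncard

/-- `G` contains an isolated copy of the complete graph on `m` vertices: `m` pairwise adjacent
vertices with no edge of `G` to any other vertex. -/
def HasIsolatedClique {V : Type*} (G : SimpleGraph V) (m : ℕ) : Prop :=
  ∃ S : Finset V, G.IsNClique m S ∧ ∀ u ∈ S, ∀ v, v ∉ S → ¬ G.Adj u v

end MinDegKruskalKatona

/-!
Write `e v = deg v - t` for the excess of a vertex. It is non-negative, since a vertex in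
`t.choose 2` triangles has degree at least `t`, and comparison with a row of cliques
`K_{t+1}`, of which only the last two overlap, bounds the total excess of an extremal graph by
`E = (t + 1) ^ 2 / 4` (`exists_blocks_graph`, `sum_excess_le`).

A vertex is low if its degree is exactly `t`; its closed neighbourhood is then a clique on `t + 1`
vertices. There are at most `E` vertices that are not low. If a vertex `x` has two low neighbours
with different closed neighbourhoods, it has at most `2 * e x` low neighbours, so that at most
`2 * E` low vertices are adjacent to such a vertex. The remaining low vertices lie in pairwise disjoint
cliques on `t + 1` vertices, the private cliques, and everything rests on a bound of order `t` for
their number when none of them is isolated. At most `t + 1` of them have more than `t / 4` leaving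
edges. The others are distinguished by their height, the largest number of neighbours that a vertex
outside has in them (`false_of_same_height`), and the height is at most `t`.

Suppose that two private cliques with few leaving edges have the same height `h`. Attach everything
that is attached to one of them to the other one instead, a vertex with `m` neighbours in the two
together being joined to the first `m` vertices of a fixed ordering. As the neighbourhoods in the
clique are now nested, no triangle is lost at vertices outside. Let `g + 1` be the largest value of
`m`, and delete the last edge to the clique at each vertex where it is attained. This saves one edge
for each of these vertices, and the lemmas `exists_repair` and `exists_repair_pair` restore the lost
triangles at the price of fewer new edges: a vertex is short of at most its degree among the
affected vertices, and of `g` more triangles if it was attached to only one of the two cliques and has no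
affected neighbour that was attached only to the other one. The second case arises only for
`g + 1 = h`, and then there are affected vertices of both kinds, any two of which share `g`
neighbours in the clique. This contradicts the minimality of the number of edges.

The resulting bound is `4 * n ≤ 11 * (t + 1) ^ 2` for every extremal graph on `n ≥ t + 1` vertices
without an isolated `K_{t+1}`, which is below `6 * t ^ 2` for `t ≥ 3`; so the error function can be
taken to be zero.
-/

namespace MinDegKruskalKatona
section
open scoped Classical
variable {V : Type*} [Fintype V]

/-! ### Triangles, degrees and cliques -/

/-- The number of neighbours of `u` inside the set `A`. -/
noncomputable def degIn {V : Type*} (G : SimpleGraph V) (u : V) (A : Finset V) : ℕ :=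
  (A.filter (G.Adj u)).card

/-- The edges of `G` between two neighbours of `u`. -/
noncomputable def linkEdges (G : SimpleGraph V) (u : V) : Finset (Sym2 V) :=
  Finset.univ.filter (fun e => e ∈ G.edgeSet ∧ ∀ a ∈ e, G.Adj u a)

theorem mem_linkEdges {G : SimpleGraph V} {u : V} {e : Sym2 V} :
    e ∈ linkEdges G u ↔ e ∈ G.edgeSet ∧ ∀ a ∈ e, G.Adj u a := by
  simp [linkEdges]

theorem two_mul_edges (G : SimpleGraph V) :
    2 * G.edgeSet.ncard = ∑ a, ∑ b, if G.Adj a b then 1 else 0 := by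
  rw [← SimpleGraph.coe_edgeFinset, Set.ncard_coe_finset, ← G.sum_degrees_eq_twice_card_edges]
  refine Finset.sum_congr rfl fun a _ => ?_
  rw [← Finset.card_filter, ← SimpleGraph.card_neighborFinset_eq_degree]
  congr 1
  ext b
  simp

theorem two_mul_edges_eq_sum_degIn (G : SimpleGraph V) :
    2 * G.edgeSet.ncard = ∑ a, degIn G a Finset.univ := by
  rw [two_mul_edges]
  refine Finset.sum_congr rfl fun a _ => ?_
  rw [degIn, Finset.card_filter]

theorem triangleDegree_eq_card_linkEdges (G : SimpleGraph V) (u : V) :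
    triangleDegree G u = (linkEdges G u).card := by
  rw [triangleDegree, ← Set.ncard_coe_finset]
  have hinj : Set.InjOn (fun e : Sym2 V => insert u e.toFinset) (linkEdges G u : Set (Sym2 V)) := by
    intro e he f hf hef
    have he' : ∀ a ∈ e, G.Adj u a := (Finset.mem_filter.1 he).2.2
    have hf' : ∀ a ∈ f, G.Adj u a := (Finset.mem_filter.1 hf).2.2
    have hue : u ∉ e.toFinset := fun h => G.loopless.irrefl u (he' u (by simpa using h))
    have huf : u ∉ f.toFinset := fun h => G.loopless.irrefl u (hf' u (by simpa using h))
    have : e.toFinset = f.toFinset := by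
      have h2 := congrArg (fun s : Finset V => s.erase u) hef
      simpa [Finset.erase_insert hue, Finset.erase_insert huf] using h2
    ext a
    have := Finset.ext_iff.1 this a
    simpa using this
  rw [← hinj.ncard_image]
  congr 1
  ext s
  simp only [Set.mem_ofPred_eq, Set.mem_image, Finset.mem_coe, linkEdges, Finset.mem_filter,
    Finset.mem_univ, true_and]
  constructor
  · rintro ⟨hs, hu⟩
    obtain ⟨a, b, c, hab, hac, hbc, rfl⟩ := SimpleGraph.is3Clique_iff.1 hs
    simp only [Finset.mem_insert, Finset.mem_singleton] at hu
    rcases hu with rfl | rfl | rfl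
    · exact ⟨s(b, c), ⟨hbc, by simp [hab, hac]⟩, by ext; simp⟩
    · exact ⟨s(a, c), ⟨hac, by simp [hab.symm, hbc]⟩, by ext; simp; tauto⟩
    · exact ⟨s(a, b), ⟨hab, by simp [hac.symm, hbc.symm]⟩, by ext; simp; tauto⟩
  · rintro ⟨e, ⟨he, hu⟩, rfl⟩
    induction e with
    | h a b =>
      have hua := hu a (by simp)
      have hub := hu b (by simp)
      refine ⟨?_, by simp⟩
      rw [SimpleGraph.is3Clique_iff]
      exact ⟨u, a, b, hua, hub, he, by ext; simp⟩

theorem two_mul_triangleDegree (G : SimpleGraph V) (u : V) :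
    2 * triangleDegree G u =
      ∑ a, ∑ b, if G.Adj u a ∧ G.Adj u b ∧ G.Adj a b then 1 else 0 := by
  let L : SimpleGraph V :=
    { Adj := fun a b => G.Adj u a ∧ G.Adj u b ∧ G.Adj a b
      symm := ⟨fun a b h => ⟨h.2.1, h.1, h.2.2.symm⟩⟩
      loopless := ⟨fun a h => G.loopless.irrefl a h.2.2⟩ }
  have h := two_mul_edges L
  have h2 : triangleDegree G u = L.edgeSet.ncard := by
    rw [triangleDegree_eq_card_linkEdges, ← Set.ncard_coe_finset]
    congr 1
    ext e
    induction e with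
    | h a b =>
      simp only [linkEdges, Finset.coe_filter, Finset.mem_univ, true_and, Set.mem_ofPred_eq,
        SimpleGraph.mem_edgeSet, Sym2.mem_iff, forall_eq_or_imp, forall_eq, L]
      tauto
  rw [h2, h]
  refine Finset.sum_congr rfl fun a _ => Finset.sum_congr rfl fun b _ => ?_
  by_cases hab : L.Adj a b
  · rw [if_pos hab, if_pos hab]
  · rw [if_neg hab, if_neg hab]

/-- New edges in the link of `u` are new triangles at `u`. -/
theorem triangleDegree_add_card_le {G H : SimpleGraph V} (hGH : G ≤ H) (u : V)
    (C : Finset (Sym2 V)) (hC : C ⊆ linkEdges H u) (hd : ∀ e ∈ C, e ∉ linkEdges G u) :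
    triangleDegree G u + C.card ≤ triangleDegree H u := by
  rw [triangleDegree_eq_card_linkEdges, triangleDegree_eq_card_linkEdges,
    ← Finset.card_union_of_disjoint]
  · apply Finset.card_le_card
    refine Finset.union_subset ?_ hC
    intro e he
    simp only [linkEdges, Finset.mem_filter, Finset.mem_univ, true_and] at he ⊢
    exact ⟨SimpleGraph.edgeSet_mono hGH he.1, fun a ha => hGH (he.2 a ha)⟩
  · rw [Finset.disjoint_left]
    intro e he hc
    exact hd e hc he

theorem triangleDegree_mono {G H : SimpleGraph V} (hGH : G ≤ H) (u : V) :
    triangleDegree G u ≤ triangleDegree H u := by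
  simpa using triangleDegree_add_card_le hGH u ∅ (by simp) (by simp)

theorem degIn_mono {V : Type*} {G H : SimpleGraph V} (hGH : G ≤ H) (u : V) (A : Finset V) :
    degIn G u A ≤ degIn H u A :=
  Finset.card_le_card (Finset.monotone_filter_right _ (fun _ _ h => hGH h))

/-- A vertex of a clique on more than `t` vertices lies in at least `t.choose 2` triangles. -/
theorem choose_le_triangleDegree_of_clique {G : SimpleGraph V} {K : Finset V} {t : ℕ} {u : V}
    (hK : ∀ a ∈ K, ∀ b ∈ K, a ≠ b → G.Adj a b) (hc : t + 1 ≤ K.card) (hu : u ∈ K) :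
    t.choose 2 ≤ triangleDegree G u := by
  have h1 : (((K.erase u).powersetCard 2).image (fun s => insert u s)).card
      = (K.card - 1).choose 2 := by
    rw [Finset.card_image_of_injOn, Finset.card_powersetCard, Finset.card_erase_of_mem hu]
    intro s hs s' hs' h
    have hs := (Finset.mem_powersetCard.1 hs).1
    have hs' := (Finset.mem_powersetCard.1 hs').1
    have h1 : u ∉ s := fun h => by simpa using hs h
    have h2 : u ∉ s' := fun h => by simpa using hs' h
    have := congrArg (fun s : Finset V => s.erase u) h
    simpa [Finset.erase_insert h1, Finset.erase_insert h2] using this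
  calc t.choose 2 ≤ (K.card - 1).choose 2 := Nat.choose_le_choose 2 (by omega)
    _ = _ := h1.symm
    _ ≤ _ := by
      rw [triangleDegree, ← Set.ncard_coe_finset]
      apply Set.ncard_le_ncard _ (Set.toFinite _)
      intro s hs
      obtain ⟨p, hp, rfl⟩ := Finset.mem_image.1 (Finset.mem_coe.1 hs)
      obtain ⟨hp1, hp2⟩ := Finset.mem_powersetCard.1 hp
      have hup : u ∉ p := fun h => by simpa using hp1 h
      refine ⟨⟨?_, by rw [Finset.card_insert_of_notMem hup, hp2]⟩, by simp⟩
      intro a ha b hb hab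
      have key : ∀ c ∈ insert u p, c ∈ K := by
        intro c hc
        rcases Finset.mem_insert.1 hc with rfl | h
        · exact hu
        · exact Finset.mem_of_mem_erase (hp1 h)
      exact hK a (key a ha) b (key b hb) hab

/-- `P` collects ordered pairs of distinct non-adjacent neighbours of `u`; together with the ordered
pairs coming from triangles at `u` they are among the `d * (d - 1)` ordered pairs of distinct
neighbours, where `d` is the degree of `u`. -/
theorem two_mul_triangleDegree_add_le (G : SimpleGraph V) (u : V) (P : Finset (V × V))
    (hP : ∀ p ∈ P, p.1 ≠ p.2 ∧ G.Adj u p.1 ∧ G.Adj u p.2 ∧ ¬ G.Adj p.1 p.2) :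
    2 * triangleDegree G u + P.card + degIn G u Finset.univ
      ≤ degIn G u Finset.univ * degIn G u Finset.univ := by
  rw [two_mul_triangleDegree, ← Finset.sum_product', ← Finset.card_filter]
  set N := Finset.univ.filter (G.Adj u)
  have h1 : N.offDiag.card
      = degIn G u Finset.univ * degIn G u Finset.univ - degIn G u Finset.univ :=
    Finset.offDiag_card N
  have h2 : ((Finset.univ ×ˢ Finset.univ).filter
      (fun x : V × V => G.Adj u x.1 ∧ G.Adj u x.2 ∧ G.Adj x.1 x.2)).card + P.card
      ≤ N.offDiag.card := by
    rw [← Finset.card_union_of_disjoint]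
    · apply Finset.card_le_card
      intro p hp
      rw [Finset.mem_offDiag]
      rcases Finset.mem_union.1 hp with h | h
      · have := (Finset.mem_filter.1 h).2
        exact ⟨by simp [N, this.1], by simp [N, this.2.1], this.2.2.ne⟩
      · have := hP p h
        exact ⟨by simp [N, this.2.1], by simp [N, this.2.2.1], this.1⟩
    · rw [Finset.disjoint_left]
      intro p hp h
      exact (hP p h).2.2.2 (Finset.mem_filter.1 hp).2.2.2
  have h3 : degIn G u Finset.univ ≤ degIn G u Finset.univ * degIn G u Finset.univ :=
    Nat.le_mul_self _
  omega

theorem le_degIn_of_choose_le {G : SimpleGraph V} {u : V} {t : ℕ} (ht : 2 ≤ t)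
    (h : t.choose 2 ≤ triangleDegree G u) : t ≤ degIn G u Finset.univ := by
  have h1 := two_mul_triangleDegree_add_le G u ∅ (by simp)
  have h2 : 2 * t.choose 2 = t * (t - 1) := by
    rw [Nat.choose_two_right, Nat.mul_div_cancel' (Nat.even_mul_pred_self t).two_dvd]
  by_contra hlt
  push Not at hlt
  set d := degIn G u Finset.univ
  simp only [Finset.card_empty] at h1
  obtain ⟨s, rfl⟩ : ∃ s, t = s + 2 := ⟨t - 2, by omega⟩
  have h3 : s + 2 - 1 = s + 1 := rfl
  rw [h3] at h2
  have : d * d ≤ d * (s + 1) := Nat.mul_le_mul_left _ (by omega)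
  have : d * s ≤ (s+1) * s := Nat.mul_le_mul_right _ (by omega)
  nlinarith

/-- A vertex of degree `t` in `t.choose 2` triangles has a complete neighbourhood. -/
theorem adj_of_degIn_eq {G : SimpleGraph V} {u : V} {t : ℕ}
    (h : t.choose 2 ≤ triangleDegree G u) (hd : degIn G u Finset.univ = t) {a b : V}
    (ha : G.Adj u a) (hb : G.Adj u b) (hab : a ≠ b) : G.Adj a b := by
  by_contra hn
  have h1 := two_mul_triangleDegree_add_le G u {(a, b)} (by simp [*])
  have h2 : 2 * t.choose 2 = t * (t - 1) := by
    rw [Nat.choose_two_right, Nat.mul_div_cancel' (Nat.even_mul_pred_self t).two_dvd]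
  rw [hd, Finset.card_singleton] at h1
  cases t with
  | zero => omega
  | succ s =>
    have h3 : s + 1 - 1 = s := rfl
    rw [h3] at h2
    nlinarith

/-! ### Repairing triangle degrees with few new edges -/

theorem ncard_edgeSet_sup_fromEdgeSet_le (G : SimpleGraph V) (C : Finset (Sym2 V)) :
    (G ⊔ SimpleGraph.fromEdgeSet (C : Set (Sym2 V))).edgeSet.ncard ≤ G.edgeSet.ncard + C.card := by
  rw [SimpleGraph.edgeSet_sup, ← Set.ncard_coe_finset C]
  refine (Set.ncard_union_le _ _).trans (Nat.add_le_add_left ?_ _)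
  apply Set.ncard_le_ncard _ (Set.toFinite _)
  rw [SimpleGraph.edgeSet_fromEdgeSet]
  exact Set.sdiff_subset

/-- The new triangles `u, q, s` at `u` through a fixed neighbour `q`: each of them has to use a new
edge among `uq` and `qs`. -/
theorem triangleDegree_add_card_le_of_common {G H : SimpleGraph V} (hGH : G ≤ H) {u q : V}
    {S : Finset V} (huq : H.Adj u q) (hS : ∀ s ∈ S, H.Adj u s ∧ H.Adj q s)
    (hn : ∀ s ∈ S, G.Adj u q → ¬ G.Adj q s) :
    triangleDegree G u + S.card ≤ triangleDegree H u := by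
  have hc : (S.image (fun s => s(q, s))).card = S.card := by
    apply Finset.card_image_of_injOn
    intro a _ b _ h
    exact Sym2.congr_right.1 h
  rw [← hc]
  apply triangleDegree_add_card_le hGH
  · intro e he
    obtain ⟨s, hs, rfl⟩ := Finset.mem_image.1 he
    simp [linkEdges, huq, hS s hs]
  · intro e he
    obtain ⟨s, hs, rfl⟩ := Finset.mem_image.1 he
    have := hn s hs
    simp only [linkEdges, Finset.mem_filter, Finset.mem_univ, true_and, SimpleGraph.mem_edgeSet,
      Sym2.mem_iff, forall_eq_or_imp, forall_eq]
    tauto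

/-- Joining a vertex `q` to all of `Z` costs one edge for each vertex of `Z` not yet adjacent
to `q`. -/
theorem exists_join (G : SimpleGraph V) {q : V} {Z : Finset V} (hq : q ∉ Z) :
    ∃ H, G ≤ H ∧ (∀ z ∈ Z, H.Adj q z) ∧
      H.edgeSet.ncard ≤ G.edgeSet.ncard + (Z.filter (fun z => ¬ G.Adj q z)).card := by
  refine ⟨G ⊔ SimpleGraph.fromEdgeSet
    (((Z.filter (fun z => ¬ G.Adj q z)).image (fun z => s(q, z)) : Finset (Sym2 V)) : Set (Sym2 V)),
    le_sup_left, ?_, (ncard_edgeSet_sup_fromEdgeSet_le _ _).trans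
      (Nat.add_le_add_left Finset.card_image_le _)⟩
  intro z hz
  rw [SimpleGraph.sup_adj]
  by_cases h : G.Adj q z
  · exact Or.inl h
  · right
    rw [SimpleGraph.fromEdgeSet_adj]
    refine ⟨?_, fun h => hq (h ▸ hz)⟩
    simp only [Finset.coe_image, Set.mem_image, Finset.mem_coe, Finset.mem_filter]
    exact ⟨z, ⟨hz, h⟩, rfl⟩

theorem degIn_filter_add {V : Type*} (G : SimpleGraph V) (u : V) (U : Finset V) (p : V → Prop)
    [DecidablePred p] :
    degIn G u (U.filter p) + degIn G u (U.filter (fun v => ¬ p v)) = degIn G u U := by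
  unfold degIn
  rw [Finset.filter_comm, Finset.filter_comm (p := fun v => ¬ p v)]
  exact Finset.card_filter_add_card_filter_not _

theorem degIn_add_one_le_card {V : Type*} (G : SimpleGraph V) {u : V} {U : Finset V} (hu : u ∈ U) :
    degIn G u U + 1 ≤ U.card := by
  have : U.filter (G.Adj u) ⊆ U.erase u := by
    intro a ha
    rw [Finset.mem_filter] at ha
    exact Finset.mem_erase.2 ⟨ha.2.ne', ha.1⟩
  have h := Finset.card_le_card this
  rw [Finset.card_erase_of_mem hu] at h
  have : 0 < U.card := Finset.card_pos.2 ⟨u, hu⟩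
  unfold degIn
  omega

/-- The base case of `exists_repair`, where all vertices of `U` have the same neighbours `W` outside
`U`. Either `U ∪ W` has fewer than `U.card` missing pairs and is made complete, or exactly
`U.card - 1` of its missing pairs are added. A vertex adjacent to all of `U ∪ W` gains a triangle
from each added pair. Any other vertex of `U` receives a new edge to another vertex of `U`, and
that edge alone brings one triangle for every vertex of `W`. -/
theorem exists_repair_of_twins {t : ℕ} {G : SimpleGraph V} {U : Finset V}
    (hne : U.Nonempty) (hsz : 2 * U.card ≤ t + 2)
    (hdeg : ∀ u ∈ U, t ≤ degIn G u Finset.univ)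
    (htri : ∀ u ∈ U, t.choose 2 ≤ triangleDegree G u + degIn G u U)
    (htwin : ∀ q, q ∉ U → (∃ u ∈ U, G.Adj q u) → ∀ u ∈ U, G.Adj q u) :
    ∃ H, G ≤ H ∧ H.edgeSet.ncard + 1 ≤ G.edgeSet.ncard + U.card ∧
      ∀ u ∈ U, t.choose 2 ≤ triangleDegree H u := by
  obtain ⟨u₀, hu₀⟩ := hne
  have hUpos : 0 < U.card := Finset.card_pos.2 ⟨u₀, hu₀⟩
  set W : Finset V := Finset.univ.filter (fun w => w ∉ U ∧ ∀ u ∈ U, G.Adj w u) with hW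
  have hdisj : Disjoint U W := by
    rw [Finset.disjoint_left]
    intro a ha hb
    exact (Finset.mem_filter.1 hb).2.1 ha
  have hdegW : ∀ u ∈ U, degIn G u Finset.univ ≤ W.card + degIn G u U := by
    intro u hu
    unfold degIn
    rw [add_comm]
    refine le_trans (Finset.card_le_card ?_) (Finset.card_union_le _ _)
    intro a ha
    have ha := (Finset.mem_filter.1 ha).2
    by_cases h : a ∈ U
    · exact Finset.mem_union_left _ (Finset.mem_filter.2 ⟨h, ha⟩)
    · exact Finset.mem_union_right _ (Finset.mem_filter.2
        ⟨Finset.mem_univ _, h, htwin a h ⟨u, hu, ha.symm⟩⟩)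
  set M : Finset (Sym2 V) := Finset.univ.filter
    (fun e => (∀ a ∈ e, a ∈ U ∪ W) ∧ ¬ e.IsDiag ∧ e ∉ G.edgeSet) with hM
  by_cases hMc : M.card + 1 ≤ U.card
  · refine ⟨G ⊔ SimpleGraph.fromEdgeSet (M : Set (Sym2 V)), le_sup_left, ?_, ?_⟩
    · have := ncard_edgeSet_sup_fromEdgeSet_le G M
      omega
    · intro u hu
      refine choose_le_triangleDegree_of_clique (K := U ∪ W) ?_ ?_ (Finset.mem_union_left _ hu)
      · intro a ha b hb hab
        rw [SimpleGraph.sup_adj, SimpleGraph.fromEdgeSet_adj]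
        by_cases h : G.Adj a b
        · exact Or.inl h
        · right
          refine ⟨?_, hab⟩
          rw [Finset.mem_coe, hM, Finset.mem_filter]
          refine ⟨Finset.mem_univ _, ?_, by simpa using hab, h⟩
          intro c hc
          rcases Sym2.mem_iff.1 hc with rfl | rfl <;> assumption
      · rw [Finset.card_union_of_disjoint hdisj]
        have h1 := hdeg u hu
        have h2 := hdegW u hu
        have h3 := degIn_add_one_le_card G hu
        omega
  · -- a set of fewer than `U.card` missing pairs that meets every vertex of `U` with a
    -- non-neighbour in `U`
    obtain ⟨C, hCM, hCc, hCcov⟩ : ∃ C ⊆ M, C.card + 1 ≤ U.card ∧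
        ∀ u ∈ U, (∃ v ∈ U, u ≠ v ∧ ¬ G.Adj u v) →
          ∃ v ∈ U, u ≠ v ∧ ¬ G.Adj u v ∧ s(u, v) ∈ C := by
      have hmem : ∀ u ∈ U, ∀ v ∈ U, u ≠ v → ¬ G.Adj u v → s(u, v) ∈ M := by
        intro u hu v hv huv hn
        rw [hM, Finset.mem_filter]
        refine ⟨Finset.mem_univ _, ?_, by simpa using huv, hn⟩
        intro c hc
        rcases Sym2.mem_iff.1 hc with rfl | rfl
        · exact Finset.mem_union_left _ hu
        · exact Finset.mem_union_left _ hv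
      by_cases hall : ∃ u ∈ U, ∃ v ∈ U, u ≠ v ∧ ¬ G.Adj u v
      · obtain ⟨a, ha, b, hb, hab, hn⟩ := hall
        have hf : ∀ u, ∃ v, (u ∈ U → (∃ v ∈ U, u ≠ v ∧ ¬ G.Adj u v) →
            v ∈ U ∧ u ≠ v ∧ ¬ G.Adj u v) ∧ (u = a → v = b) := by
          intro u
          by_cases hu : u = a
          · subst hu
            exact ⟨b, fun _ _ => ⟨hb, hab, hn⟩, fun _ => rfl⟩
          · by_cases h : ∃ v ∈ U, u ≠ v ∧ ¬ G.Adj u v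
            · obtain ⟨v, hv⟩ := h
              exact ⟨v, fun _ _ => hv, fun h => absurd h hu⟩
            · exact ⟨b, fun _ h' => absurd h' h, fun h => absurd h hu⟩
        choose f hf hfa using hf
        refine ⟨((U.filter (fun u => ∃ v ∈ U, u ≠ v ∧ ¬ G.Adj u v)).erase b).image
          (fun u => s(u, f u)), ?_, ?_, ?_⟩
        · intro e he
          obtain ⟨u, hu, rfl⟩ := Finset.mem_image.1 he
          have hu := Finset.mem_filter.1 (Finset.mem_of_mem_erase hu)
          obtain ⟨h1, h2, h3⟩ := hf u hu.1 hu.2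
          exact hmem u hu.1 _ h1 h2 h3
        · have h1 : ((U.filter (fun u => ∃ v ∈ U, u ≠ v ∧ ¬ G.Adj u v)).erase b) ⊆ U.erase b :=
            Finset.erase_subset_erase _ (Finset.filter_subset _ _)
          have h2 := Finset.card_le_card h1
          rw [Finset.card_erase_of_mem hb] at h2
          have h3 := Finset.card_image_le (f := fun u => s(u, f u))
            (s := ((U.filter (fun u => ∃ v ∈ U, u ≠ v ∧ ¬ G.Adj u v)).erase b))
          omega
        · intro u hu hex
          by_cases hub : u = b
          · subst hub
            refine ⟨a, ha, hab.symm, fun h => hn h.symm, Finset.mem_image.2 ⟨a, ?_, ?_⟩⟩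
            · exact Finset.mem_erase.2 ⟨hab, Finset.mem_filter.2 ⟨ha, u, hu, hab, hn⟩⟩
            · simp only [hfa a rfl]
              exact Sym2.eq_swap
          · obtain ⟨h1, h2, h3⟩ := hf u hu hex
            exact ⟨f u, h1, h2, h3, Finset.mem_image.2
              ⟨u, Finset.mem_erase.2 ⟨hub, Finset.mem_filter.2 ⟨hu, hex⟩⟩, rfl⟩⟩
      · refine ⟨∅, by simp, by simpa using hUpos, ?_⟩
        rintro u hu ⟨v, hv, h⟩
        exact absurd ⟨u, hu, v, hv, h⟩ hall
    obtain ⟨C', hCC', hC'M, hC'c⟩ := Finset.exists_subsuperset_card_eq hCM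
      (n := U.card - 1) (by omega) (by omega)
    refine ⟨G ⊔ SimpleGraph.fromEdgeSet (C' : Set (Sym2 V)), le_sup_left, ?_, ?_⟩
    · have := ncard_edgeSet_sup_fromEdgeSet_le G C'
      omega
    intro u hu
    have hU1 := degIn_add_one_le_card G hu
    refine (htri u hu).trans ?_
    by_cases hex : ∃ v ∈ U, u ≠ v ∧ ¬ G.Adj u v
    · -- a new edge from `u` to a twin creates a triangle with each vertex of `W`
      obtain ⟨v, hv, huv, hn, hC⟩ := hCcov u hu hex
      have h1 := triangleDegree_add_card_le_of_common
        (G := G) (H := G ⊔ SimpleGraph.fromEdgeSet (C' : Set (Sym2 V))) le_sup_left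
        (u := u) (q := v) (S := W) ?_ ?_ ?_
      · have h2 := hdeg u hu
        have h3 := hdegW u hu
        omega
      · rw [SimpleGraph.sup_adj, SimpleGraph.fromEdgeSet_adj]
        exact Or.inr ⟨by exact_mod_cast hCC' hC, huv⟩
      · intro s hs
        have hs := (Finset.mem_filter.1 hs).2.2
        rw [SimpleGraph.sup_adj, SimpleGraph.sup_adj]
        exact ⟨Or.inl (hs u hu).symm, Or.inl (hs v hv).symm⟩
      · intro s _ h
        exact absurd h hn
    · push Not at hex
      have hadj : ∀ a ∈ U ∪ W, u ≠ a → G.Adj u a := by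
        intro a ha hua
        rcases Finset.mem_union.1 ha with h | h
        · exact hex a h hua
        · exact ((Finset.mem_filter.1 h).2.2 u hu).symm
      have h1 := triangleDegree_add_card_le
        (G := G) (H := G ⊔ SimpleGraph.fromEdgeSet (C' : Set (Sym2 V))) le_sup_left u C' ?_ ?_
      · omega
      · intro e he
        obtain ⟨-, h1, h2, h3⟩ := Finset.mem_filter.1 (hC'M he)
        have hue : u ∉ e := by
          intro hue
          obtain ⟨b, rfl⟩ := hue
          exact h3 (hadj b (h1 b (by simp)) (by simpa using h2))
        rw [mem_linkEdges, SimpleGraph.edgeSet_sup, SimpleGraph.edgeSet_fromEdgeSet]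
        refine ⟨Or.inr ⟨by exact_mod_cast he, h2⟩, fun a ha => ?_⟩
        rw [SimpleGraph.sup_adj]
        exact Or.inl (hadj a (h1 a ha) (fun h => hue (h ▸ ha)))
      · intro e he h
        exact (Finset.mem_filter.1 (hC'M he)).2.2.2 (mem_linkEdges.1 h).1

/-- If every `u ∈ U` is short of `t.choose 2` triangles by at most its degree inside `U`, fewer than
`U.card` new edges repair all of `U`. A vertex `q` outside `U` that is adjacent to some but not all
of `U` is joined to the rest of `U`: the newly joined vertices are repaired, and the others are
now short by at most their degree inside `U ∩ N(q)`, on which one recurses. -/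
theorem exists_repair {t : ℕ} (U : Finset V) : ∀ (G : SimpleGraph V),
    U.Nonempty → 2 * U.card ≤ t + 2 →
    (∀ u ∈ U, t ≤ degIn G u Finset.univ) →
    (∀ u ∈ U, t.choose 2 ≤ triangleDegree G u + degIn G u U) →
    ∃ H, G ≤ H ∧ H.edgeSet.ncard + 1 ≤ G.edgeSet.ncard + U.card ∧
      ∀ u ∈ U, t.choose 2 ≤ triangleDegree H u := by
  induction U using Finset.strongInduction with
  | H U ih =>
    intro G hne hsz hdeg htri
    by_cases htwin : ∀ q, q ∉ U → (∃ u ∈ U, G.Adj q u) → ∀ u ∈ U, G.Adj q u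
    · exact exists_repair_of_twins hne hsz hdeg htri htwin
    push Not at htwin
    obtain ⟨q, hq, ⟨a, ha, hqa⟩, b, hb, hqb⟩ := htwin
    obtain ⟨G₁, hG₁, hjoin, hcard⟩ := exists_join G hq
    have hss : U.filter (G.Adj q) ⊂ U := by
      refine Finset.filter_ssubset.2 ⟨b, hb, hqb⟩
    have hle := Finset.card_lt_card hss
    obtain ⟨H, hH, hHc, hHt⟩ := ih _ hss G₁ ⟨a, Finset.mem_filter.2 ⟨ha, hqa⟩⟩ (by omega)
      (fun u hu => (hdeg u (Finset.mem_filter.1 hu).1).trans (degIn_mono hG₁ _ _)) (by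
        intro u hu
        obtain ⟨hu, hqu⟩ := Finset.mem_filter.1 hu
        have h1 := triangleDegree_add_card_le_of_common hG₁ (u := u) (q := q)
          (S := (U.filter (fun v => ¬ G.Adj q v)).filter (G.Adj u)) (hG₁ hqu.symm) (by
            intro s hs
            simp only [Finset.mem_filter] at hs
            exact ⟨hG₁ hs.2, hjoin s hs.1.1⟩) (by
            intro s hs _
            simp only [Finset.mem_filter] at hs
            exact hs.1.2)
        have h2 := degIn_filter_add G u U (G.Adj q)
        have h3 := htri u hu
        have h4 := degIn_mono hG₁ u (U.filter (G.Adj q))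
        unfold degIn at *
        omega)
    refine ⟨H, hG₁.trans hH, ?_, ?_⟩
    · have := Finset.card_filter_add_card_filter_not (s := U) (G.Adj q)
      omega
    · intro u hu
      by_cases hqu : G.Adj q u
      · exact hHt u (Finset.mem_filter.2 ⟨hu, hqu⟩)
      · refine le_trans ?_ (triangleDegree_mono hH u)
        have h1 := triangleDegree_add_card_le_of_common hG₁ (u := u) (q := q)
          (S := U.filter (G.Adj u)) (hjoin u hu).symm (by
            intro s hs
            simp only [Finset.mem_filter] at hs
            exact ⟨hG₁ hs.2, hjoin s hs.1⟩) (fun s _ h => absurd h.symm hqu)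
        exact (htri u hu).trans h1

/-- The case of `exists_repair_pair` in which some `x₁ ∈ X` has no neighbour in `Y`. Joining `x₁` to
`Y` repairs `Y`; joining some `y₁ ∈ Y` to `X` then reuses the edge `x₁y₁`, and leaves only
`X ∩ N(y₁)` to `exists_repair`. -/
theorem exists_repair_pair_aux {t a : ℕ} {G : SimpleGraph V} {X Y : Finset V}
    (hY : Y.Nonempty) (hXY : Disjoint X Y) (hXc : 2 * X.card ≤ t + 2)
    (hXd : ∀ x ∈ X, t ≤ degIn G x Finset.univ)
    (hX1 : ∀ x ∈ X, t.choose 2 ≤ triangleDegree G x + degIn G x X + a)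
    (hX2 : ∀ x ∈ X, (∃ y ∈ Y, G.Adj x y) → t.choose 2 ≤ triangleDegree G x + degIn G x X)
    (hY1 : ∀ y ∈ Y, t.choose 2 ≤ triangleDegree G y + degIn G y Y + a)
    (hcom : ∀ x ∈ X, ∀ y ∈ Y, ∃ S : Finset V, S.card = a ∧ Disjoint S (X ∪ Y) ∧
      ∀ s ∈ S, G.Adj x s ∧ G.Adj y s)
    {x₁ : V} (hx₁ : x₁ ∈ X) (hx₁Y : ∀ y ∈ Y, ¬ G.Adj x₁ y) :
    ∃ H, G ≤ H ∧ H.edgeSet.ncard + 1 ≤ G.edgeSet.ncard + (X.card + Y.card) ∧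
      ∀ u ∈ X ∪ Y, t.choose 2 ≤ triangleDegree H u := by
  obtain ⟨y₁, hy₁⟩ := hY
  obtain ⟨H₁, hGH₁, hj₁, hc₁⟩ := exists_join G (Finset.disjoint_left.1 hXY hx₁)
  obtain ⟨H₂, hH₁₂, hj₂, hc₂⟩ := exists_join H₁ (Finset.disjoint_right.1 hXY hy₁)
  have hGH₂ := hGH₁.trans hH₁₂
  set U := X.filter (fun x => G.Adj y₁ x ∨ x = x₁) with hU
  have hUX : U ⊆ X := Finset.filter_subset _ _
  have hYsat : ∀ y ∈ Y, t.choose 2 ≤ triangleDegree H₁ y := by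
    intro y hy
    obtain ⟨S, hSc, hSd, hS⟩ := hcom x₁ hx₁ y hy
    have h := triangleDegree_add_card_le_of_common hGH₁ (u := y) (q := x₁)
      (S := S ∪ Y.filter (G.Adj y)) (hj₁ y hy).symm (by
        intro s hs
        rcases Finset.mem_union.1 hs with hs | hs
        · exact ⟨hGH₁ (hS s hs).2, hGH₁ (hS s hs).1⟩
        · exact ⟨hGH₁ (Finset.mem_filter.1 hs).2, hj₁ s (Finset.mem_filter.1 hs).1⟩)
      (fun s _ h => absurd h.symm (hx₁Y y hy))
    rw [Finset.card_union_of_disjoint (Finset.disjoint_of_subset_right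
      ((Finset.filter_subset _ _).trans Finset.subset_union_right) hSd)] at h
    have := hY1 y hy
    unfold degIn at this
    omega
  have hXsat : ∀ x ∈ X, ¬ G.Adj y₁ x → t.choose 2 ≤ triangleDegree H₂ x := by
    intro x hx hn
    obtain ⟨S, hSc, hSd, hS⟩ := hcom x hx y₁ hy₁
    have h := triangleDegree_add_card_le_of_common hGH₂ (u := x) (q := y₁)
      (S := S ∪ X.filter (G.Adj x)) (hj₂ x hx).symm (by
        intro s hs
        rcases Finset.mem_union.1 hs with hs | hs
        · exact ⟨hGH₂ (hS s hs).1, hGH₂ (hS s hs).2⟩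
        · exact ⟨hGH₂ (Finset.mem_filter.1 hs).2, hj₂ s (Finset.mem_filter.1 hs).1⟩)
      (fun s _ h => absurd h.symm hn)
    rw [Finset.card_union_of_disjoint (Finset.disjoint_of_subset_right
      ((Finset.filter_subset _ _).trans Finset.subset_union_left) hSd)] at h
    have := hX1 x hx
    unfold degIn at this
    omega
  have hUc := Finset.card_le_card hUX
  obtain ⟨H, hH, hHc, hHt⟩ := exists_repair (t := t) U H₂
    ⟨x₁, Finset.mem_filter.2 ⟨hx₁, Or.inr rfl⟩⟩ (by omega)
    (fun u hu => (hXd u (hUX hu)).trans (degIn_mono hGH₂ _ _)) (by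
      intro u hu
      by_cases hadj : G.Adj y₁ u
      · have h1 := triangleDegree_add_card_le_of_common hGH₂ (u := u) (q := y₁)
          (S := (X.filter (fun x => ¬ (G.Adj y₁ x ∨ x = x₁))).filter (G.Adj u))
          (hj₂ u (hUX hu)).symm (by
            intro s hs
            simp only [Finset.mem_filter] at hs
            exact ⟨hGH₂ hs.2, hj₂ s hs.1.1⟩) (by
            intro s hs _ h
            simp only [Finset.mem_filter] at hs
            exact hs.1.2 (Or.inl h))
        have h2 := degIn_filter_add G u X (fun x => G.Adj y₁ x ∨ x = x₁)
        have h3 := hX2 u (hUX hu) ⟨y₁, hy₁, hadj.symm⟩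
        have h4 := degIn_mono hGH₂ u U
        rw [← hU] at h2
        unfold degIn at *
        omega
      · exact (hXsat u (hUX hu) hadj).trans (Nat.le_add_right _ _))
  refine ⟨H, hGH₂.trans hH, ?_, ?_⟩
  · have h1 : (X.filter (fun z => ¬ H₁.Adj y₁ z)).card + U.card ≤ X.card := by
      rw [← Finset.card_filter_add_card_filter_not (s := X) (fun x => G.Adj y₁ x ∨ x = x₁),
        ← hU, add_comm]
      refine Nat.add_le_add_left (Finset.card_le_card ?_) _
      refine Finset.monotone_filter_right _ ?_
      rintro x _ hx (h | rfl)
      · exact hx (hGH₁ h)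
      · exact hx (hj₁ y₁ hy₁).symm
    have h2 : (Y.filter (fun z => ¬ G.Adj x₁ z)).card ≤ Y.card := Finset.card_filter_le _ _
    omega
  · intro u hu
    rcases Finset.mem_union.1 hu with hu | hu
    · by_cases hadj : G.Adj y₁ u
      · exact hHt u (Finset.mem_filter.2 ⟨hu, Or.inl hadj⟩)
      · exact (hXsat u hu hadj).trans (triangleDegree_mono hH u)
    · exact (hYsat u hu).trans (triangleDegree_mono (hH₁₂.trans hH) u)

/-- The vertices of `X` and `Y` may be short by `a` more than in `exists_repair`, but only when they
have no neighbour on the other side, and any `x ∈ X` and `y ∈ Y` have `a` common neighbours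
outside, so that a new edge `xy` brings at least `a` triangles at both of its ends. Then fewer than
`X.card + Y.card` new edges repair `X ∪ Y`. -/
theorem exists_repair_pair {t a : ℕ} {G : SimpleGraph V} {X Y : Finset V}
    (hX : X.Nonempty) (hY : Y.Nonempty) (hXY : Disjoint X Y)
    (hXc : 2 * X.card ≤ t + 2) (hYc : 2 * Y.card ≤ t + 2)
    (hXd : ∀ x ∈ X, t ≤ degIn G x Finset.univ) (hYd : ∀ y ∈ Y, t ≤ degIn G y Finset.univ)
    (hX1 : ∀ x ∈ X, t.choose 2 ≤ triangleDegree G x + degIn G x X + a)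
    (hX2 : ∀ x ∈ X, (∃ y ∈ Y, G.Adj x y) → t.choose 2 ≤ triangleDegree G x + degIn G x X)
    (hY1 : ∀ y ∈ Y, t.choose 2 ≤ triangleDegree G y + degIn G y Y + a)
    (hY2 : ∀ y ∈ Y, (∃ x ∈ X, G.Adj y x) → t.choose 2 ≤ triangleDegree G y + degIn G y Y)
    (hcom : ∀ x ∈ X, ∀ y ∈ Y, ∃ S : Finset V, S.card = a ∧ Disjoint S (X ∪ Y) ∧
      ∀ s ∈ S, G.Adj x s ∧ G.Adj y s) :
    ∃ H, G ≤ H ∧ H.edgeSet.ncard + 1 ≤ G.edgeSet.ncard + (X.card + Y.card) ∧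
      ∀ u ∈ X ∪ Y, t.choose 2 ≤ triangleDegree H u := by
  by_cases h1 : ∃ x ∈ X, ∀ y ∈ Y, ¬ G.Adj x y
  · obtain ⟨x₁, hx₁, h⟩ := h1
    exact exists_repair_pair_aux hY hXY hXc hXd hX1 hX2 hY1 hcom hx₁ h
  by_cases h2 : ∃ y ∈ Y, ∀ x ∈ X, ¬ G.Adj y x
  · obtain ⟨y₁, hy₁, h⟩ := h2
    rw [Finset.union_comm, add_comm X.card]
    refine exists_repair_pair_aux hX hXY.symm hYc hYd hY1 hY2 hX1 ?_ hy₁ h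
    intro y hy x hx
    obtain ⟨S, hSc, hSd, hS⟩ := hcom x hx y hy
    exact ⟨S, hSc, by rwa [Finset.union_comm], fun s hs => (hS s hs).symm⟩
  push Not at h1 h2
  obtain ⟨H₁, hH₁, hc₁, ht₁⟩ := exists_repair (t := t) X G hX hXc hXd
    (fun x hx => hX2 x hx (h1 x hx))
  obtain ⟨H₂, hH₂, hc₂, ht₂⟩ := exists_repair (t := t) Y H₁ hY hYc
    (fun y hy => (hYd y hy).trans (degIn_mono hH₁ _ _))
    (fun y hy => (hY2 y hy (h2 y hy)).trans
      (add_le_add (triangleDegree_mono hH₁ y) (degIn_mono hH₁ _ _)))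
  refine ⟨H₂, hH₁.trans hH₂, by omega, fun u hu => ?_⟩
  rcases Finset.mem_union.1 hu with hu | hu
  · exact (ht₁ u hu).trans (triangleDegree_mono hH₂ u)
  · exact ht₂ u hu

/-! ### Merging two cliques -/

theorem sum_degIn_comm {V : Type*} (G : SimpleGraph V) (A B : Finset V) :
    ∑ a ∈ A, degIn G a B = ∑ b ∈ B, degIn G b A := by
  simp only [degIn, Finset.card_filter]
  rw [Finset.sum_comm]
  simp only [G.adj_comm]

theorem sum_univ_eq_of_disjoint {K₁ K₂ : Finset V} (hd : Disjoint K₁ K₂) (f : V → ℕ) :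
    ∑ v, f v = ∑ v ∈ (K₁ ∪ K₂)ᶜ, f v + ∑ v ∈ K₁, f v + ∑ v ∈ K₂, f v := by
  rw [add_assoc, ← Finset.sum_union hd, add_comm, Finset.sum_add_sum_compl]

theorem degIn_univ_eq (G : SimpleGraph V) {K₁ K₂ : Finset V} (hd : Disjoint K₁ K₂) (v : V) :
    degIn G v Finset.univ = degIn G v (K₁ ∪ K₂)ᶜ + degIn G v K₁ + degIn G v K₂ := by
  simp only [degIn, Finset.card_filter]
  exact sum_univ_eq_of_disjoint hd _

theorem degIn_clique {V : Type*} {G : SimpleGraph V} {K : Finset V} {t : ℕ}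
    (hK : ∀ a ∈ K, ∀ b ∈ K, a ≠ b → G.Adj a b) (hc : K.card = t + 1) {a : V} (ha : a ∈ K) :
    degIn G a K = t := by
  have : K.filter (G.Adj a) = K.erase a := by
    ext b
    rw [Finset.mem_filter, Finset.mem_erase]
    exact ⟨fun h => ⟨h.2.ne', h.1⟩, fun h => ⟨h.2, hK a ha b h.2 h.1.symm⟩⟩
  rw [degIn, this, Finset.card_erase_of_mem ha, hc]
  rfl

theorem ncard_edgeSet_eq {G : SimpleGraph V} {K₁ K₂ : Finset V} {t : ℕ} (hd : Disjoint K₁ K₂)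
    (hK₁ : ∀ a ∈ K₁, ∀ b ∈ K₁, a ≠ b → G.Adj a b) (hc₁ : K₁.card = t + 1)
    (hK₂ : ∀ a ∈ K₂, ∀ b ∈ K₂, a ≠ b → G.Adj a b) (hc₂ : K₂.card = t + 1) :
    2 * G.edgeSet.ncard = ∑ y ∈ (K₁ ∪ K₂)ᶜ, degIn G y (K₁ ∪ K₂)ᶜ
      + 2 * ∑ y ∈ (K₁ ∪ K₂)ᶜ, (degIn G y K₁ + degIn G y K₂)
      + 2 * ((t + 1) * t) + 2 * ∑ a ∈ K₁, degIn G a K₂ := by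
  rw [two_mul_edges_eq_sum_degIn, sum_univ_eq_of_disjoint hd]
  simp only [degIn_univ_eq G hd, Finset.sum_add_distrib]
  have h1 : ∑ a ∈ K₁, degIn G a K₁ = (t + 1) * t := by
    rw [Finset.sum_congr rfl (fun a ha => degIn_clique hK₁ hc₁ ha)]
    simp [hc₁]
  have h2 : ∑ a ∈ K₂, degIn G a K₂ = (t + 1) * t := by
    rw [Finset.sum_congr rfl (fun a ha => degIn_clique hK₂ hc₂ ha)]
    simp [hc₂]
  rw [h1, h2, sum_degIn_comm G K₁ (K₁ ∪ K₂)ᶜ, sum_degIn_comm G K₂ (K₁ ∪ K₂)ᶜ,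
    sum_degIn_comm G K₂ K₁]
  ring

/-- The number of common neighbours of `y` and `z` inside the set `A`. -/
noncomputable def codegIn {V : Type*} (G : SimpleGraph V) (y z : V) (A : Finset V) : ℕ :=
  (A.filter (fun k => G.Adj y k ∧ G.Adj z k)).card

/-- The number of ordered pairs in `A × B` that form a triangle with `y`. -/
noncomputable def trianglePairs {V : Type*} (G : SimpleGraph V) (y : V) (A B : Finset V) : ℕ :=
  ∑ a ∈ A, ∑ b ∈ B, if G.Adj y a ∧ G.Adj y b ∧ G.Adj a b then 1 else 0

theorem trianglePairs_comm {V : Type*} (G : SimpleGraph V) (y : V) (A B : Finset V) :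
    trianglePairs G y A B = trianglePairs G y B A := by
  unfold trianglePairs
  rw [Finset.sum_comm]
  refine Finset.sum_congr rfl fun b _ => Finset.sum_congr rfl fun a _ => if_congr ?_ rfl rfl
  rw [G.adj_comm a b]
  tauto

theorem trianglePairs_eq_sum_codegIn {V : Type*} (G : SimpleGraph V) (y : V) (A B : Finset V) :
    trianglePairs G y A B = ∑ z ∈ A.filter (G.Adj y), codegIn G y z B := by
  rw [trianglePairs, Finset.sum_filter]
  refine Finset.sum_congr rfl fun a _ => ?_
  split_ifs with h
  · rw [codegIn, Finset.card_filter]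
    simp [h]
  · simp [h]

theorem trianglePairs_clique {V : Type*} {G : SimpleGraph V} {K : Finset V}
    (hK : ∀ a ∈ K, ∀ b ∈ K, a ≠ b → G.Adj a b) (y : V) :
    trianglePairs G y K K + degIn G y K = degIn G y K * degIn G y K := by
  have h : trianglePairs G y K K = (K.filter (G.Adj y)).offDiag.card := by
    rw [trianglePairs, ← Finset.sum_product', ← Finset.card_filter]
    congr 1
    ext ⟨a, b⟩
    simp only [Finset.mem_filter, Finset.mem_product, Finset.mem_offDiag]
    constructor
    · rintro ⟨⟨ha, hb⟩, h1, h2, h3⟩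
      exact ⟨⟨ha, h1⟩, ⟨hb, h2⟩, h3.ne⟩
    · rintro ⟨⟨ha, h1⟩, ⟨hb, h2⟩, h3⟩
      exact ⟨⟨ha, hb⟩, h1, h2, hK a ha b hb h3⟩
  rw [h, Finset.offDiag_card, degIn]
  exact Nat.sub_add_cancel (Nat.le_mul_self _)

/-- The ordered triangles at `y`, split by the positions of their other two vertices relative to two
disjoint cliques. -/
theorem two_mul_triangleDegree_eq {G : SimpleGraph V} {K₁ K₂ : Finset V} (hd : Disjoint K₁ K₂)
    (hK₁ : ∀ a ∈ K₁, ∀ b ∈ K₁, a ≠ b → G.Adj a b)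
    (hK₂ : ∀ a ∈ K₂, ∀ b ∈ K₂, a ≠ b → G.Adj a b) (y : V) :
    2 * triangleDegree G y + degIn G y K₁ + degIn G y K₂
      = trianglePairs G y (K₁ ∪ K₂)ᶜ (K₁ ∪ K₂)ᶜ
      + 2 * ∑ z ∈ (K₁ ∪ K₂)ᶜ.filter (G.Adj y), (codegIn G y z K₁ + codegIn G y z K₂)
      + degIn G y K₁ * degIn G y K₁ + degIn G y K₂ * degIn G y K₂
      + 2 * trianglePairs G y K₁ K₂ := by
  have h : 2 * triangleDegree G y = trianglePairs G y Finset.univ Finset.univ :=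
    two_mul_triangleDegree G y
  have hr : ∀ A, trianglePairs G y A Finset.univ = trianglePairs G y A (K₁ ∪ K₂)ᶜ
      + trianglePairs G y A K₁ + trianglePairs G y A K₂ := by
    intro A
    simp only [trianglePairs, ← Finset.sum_add_distrib]
    exact Finset.sum_congr rfl fun a _ => sum_univ_eq_of_disjoint hd _
  rw [h, hr, trianglePairs_comm _ _ _ (K₁ ∪ K₂)ᶜ, trianglePairs_comm _ _ _ K₁,
    trianglePairs_comm _ _ _ K₂, hr, hr, hr, trianglePairs_comm _ _ K₁ (K₁ ∪ K₂)ᶜ,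
    trianglePairs_comm _ _ K₂ (K₁ ∪ K₂)ᶜ, trianglePairs_comm _ _ K₂ K₁,
    trianglePairs_eq_sum_codegIn G y (K₁ ∪ K₂)ᶜ K₁, trianglePairs_eq_sum_codegIn G y (K₁ ∪ K₂)ᶜ K₂,
    Finset.sum_add_distrib, ← trianglePairs_clique hK₁ y, ← trianglePairs_clique hK₂ y]
  ring

theorem codegIn_le_min {V : Type*} (G : SimpleGraph V) (y z : V) (A : Finset V) :
    codegIn G y z A ≤ min (degIn G y A) (degIn G z A) :=
  le_min (Finset.card_le_card (Finset.monotone_filter_right _ fun _ _ h => h.1))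
    (Finset.card_le_card (Finset.monotone_filter_right _ fun _ _ h => h.2))

theorem trianglePairs_le_mul {V : Type*} (G : SimpleGraph V) (y : V) (A B : Finset V) :
    trianglePairs G y A B ≤ degIn G y A * degIn G y B := by
  rw [trianglePairs_eq_sum_codegIn, degIn, ← smul_eq_mul]
  exact Finset.sum_le_card_nsmul _ _ _ fun z _ => (codegIn_le_min G y z B).trans (min_le_left _ _)

/-- Both cliques `K₁`, `K₂` are kept, `K₂` is cut off from the rest of the graph, and each vertex
`y` outside is joined to exactly those vertices of `K₁` whose rank `ρ` is below `μ y`. -/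
def mergeGraph {V : Type*} [DecidableEq V] (G : SimpleGraph V) (K₁ K₂ : Finset V) (ρ μ : V → ℕ) :
    SimpleGraph V where
  Adj a b := (a ∉ K₁ ∪ K₂ ∧ b ∉ K₁ ∪ K₂ ∧ G.Adj a b) ∨
    (a ∉ K₁ ∪ K₂ ∧ b ∈ K₁ ∧ ρ b < μ a) ∨ (b ∉ K₁ ∪ K₂ ∧ a ∈ K₁ ∧ ρ a < μ b) ∨
    (a ≠ b ∧ (a ∈ K₁ ∧ b ∈ K₁ ∨ a ∈ K₂ ∧ b ∈ K₂))
  symm := ⟨fun a b h => by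
    rcases h with ⟨h1, h2, h3⟩ | h | h | ⟨h1, h2⟩
    · exact Or.inl ⟨h2, h1, h3.symm⟩
    · exact Or.inr (Or.inr (Or.inl h))
    · exact Or.inr (Or.inl h)
    · exact Or.inr (Or.inr (Or.inr ⟨h1.symm, by tauto⟩))⟩
  loopless := ⟨fun a h => by
    rcases h with ⟨_, _, h⟩ | ⟨h1, h2, _⟩ | ⟨h1, h2, _⟩ | ⟨h, _⟩
    · exact G.loopless.irrefl a h
    · exact h1 (Finset.mem_union_left _ h2)
    · exact h1 (Finset.mem_union_left _ h2)
    · exact h rfl⟩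

/-- A ranking of `K`: for every `j ≤ K.card` exactly `j` vertices of `K` have rank below `j`. -/
theorem exists_rank {V : Type*} (K : Finset V) :
    ∃ ρ : V → ℕ, ∀ j ≤ K.card, (K.filter (fun k => ρ k < j)).card = j := by
  refine ⟨fun v => if h : v ∈ K then (K.equivFin ⟨v, h⟩ : ℕ) else 0, fun j hj => ?_⟩
  rw [← Finset.card_range j]
  refine Finset.card_bij (fun v _ => if h : v ∈ K then (K.equivFin ⟨v, h⟩ : ℕ) else 0) ?_ ?_ ?_
  · intro a ha
    simpa using (Finset.mem_filter.1 ha).2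
  · intro a ha b hb hab
    have ha := (Finset.mem_filter.1 ha).1
    have hb := (Finset.mem_filter.1 hb).1
    simp only [ha, hb, dif_pos] at hab
    have := K.equivFin.injective (Fin.ext hab)
    simpa using this
  · intro i hi
    have hi := Finset.mem_range.1 hi
    refine ⟨K.equivFin.symm ⟨i, by omega⟩, ?_, ?_⟩
    · rw [Finset.mem_filter]
      refine ⟨Subtype.prop _, ?_⟩
      simp [hi]
    · simp

section Merge
variable {V : Type*} {G : SimpleGraph V} {K₁ K₂ : Finset V} {ρ μ : V → ℕ} {t : ℕ}

theorem mergeGraph_adj_of_notMem {a b : V} (ha : a ∉ K₁ ∪ K₂) (hb : b ∉ K₁ ∪ K₂) :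
    (mergeGraph G K₁ K₂ ρ μ).Adj a b ↔ G.Adj a b := by
  simp only [Finset.mem_union, not_or] at ha hb
  simp [mergeGraph, ha, hb]

theorem mergeGraph_adj_left {a b : V} (ha : a ∉ K₁ ∪ K₂) (hb : b ∈ K₁) :
    (mergeGraph G K₁ K₂ ρ μ).Adj a b ↔ ρ b < μ a := by
  simp only [Finset.mem_union, not_or] at ha
  simp [mergeGraph, ha, hb]

theorem mergeGraph_not_adj_right (hd : Disjoint K₁ K₂) {a b : V} (ha : a ∉ K₂) (hb : b ∈ K₂) :
    ¬ (mergeGraph G K₁ K₂ ρ μ).Adj a b := by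
  have hb' := Finset.disjoint_right.1 hd hb
  simp [mergeGraph, ha, hb, hb']

theorem mergeGraph_clique_left :
    ∀ a ∈ K₁, ∀ b ∈ K₁, a ≠ b → (mergeGraph G K₁ K₂ ρ μ).Adj a b :=
  fun _ ha _ hb hab => Or.inr (Or.inr (Or.inr ⟨hab, Or.inl ⟨ha, hb⟩⟩))

theorem mergeGraph_clique_right :
    ∀ a ∈ K₂, ∀ b ∈ K₂, a ≠ b → (mergeGraph G K₁ K₂ ρ μ).Adj a b :=
  fun _ ha _ hb hab => Or.inr (Or.inr (Or.inr ⟨hab, Or.inr ⟨ha, hb⟩⟩))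

theorem degIn_mergeGraph_of_disjoint {A : Finset V} (hA : Disjoint A (K₁ ∪ K₂)) {a : V}
    (ha : a ∉ K₁ ∪ K₂) : degIn (mergeGraph G K₁ K₂ ρ μ) a A = degIn G a A := by
  unfold degIn
  congr 1
  refine Finset.filter_congr fun b hb => ?_
  rw [mergeGraph_adj_of_notMem ha (Finset.disjoint_left.1 hA hb)]

theorem degIn_mergeGraph_left (hρ : ∀ j ≤ K₁.card, (K₁.filter (fun k => ρ k < j)).card = j)
    {a : V} (ha : a ∉ K₁ ∪ K₂) (hμ : μ a ≤ K₁.card) :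
    degIn (mergeGraph G K₁ K₂ ρ μ) a K₁ = μ a := by
  rw [← hρ _ hμ, degIn]
  congr 1
  exact Finset.filter_congr fun b hb => mergeGraph_adj_left ha hb

theorem degIn_mergeGraph_right (hd : Disjoint K₁ K₂) {a : V} (ha : a ∉ K₂) :
    degIn (mergeGraph G K₁ K₂ ρ μ) a K₂ = 0 := by
  rw [degIn, Finset.card_eq_zero, Finset.filter_eq_empty_iff]
  exact fun b hb => mergeGraph_not_adj_right hd ha hb

theorem codegIn_mergeGraph_left (hρ : ∀ j ≤ K₁.card, (K₁.filter (fun k => ρ k < j)).card = j)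
    {a b : V} (ha : a ∉ K₁ ∪ K₂) (hb : b ∉ K₁ ∪ K₂) (hμ : μ a ≤ K₁.card) :
    codegIn (mergeGraph G K₁ K₂ ρ μ) a b K₁ = min (μ a) (μ b) := by
  rw [← hρ (min (μ a) (μ b)) ((min_le_left _ _).trans hμ), codegIn]
  congr 1
  refine Finset.filter_congr fun k hk => ?_
  rw [mergeGraph_adj_left ha hk, mergeGraph_adj_left hb hk, lt_min_iff]

theorem ncard_edgeSet_mergeGraph [Fintype V] (hd : Disjoint K₁ K₂)
    (hK₁ : ∀ a ∈ K₁, ∀ b ∈ K₁, a ≠ b → G.Adj a b) (hc₁ : K₁.card = t + 1)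
    (hK₂ : ∀ a ∈ K₂, ∀ b ∈ K₂, a ≠ b → G.Adj a b) (hc₂ : K₂.card = t + 1)
    (hρ : ∀ j ≤ K₁.card, (K₁.filter (fun k => ρ k < j)).card = j)
    (hμ : ∀ y ∈ (K₁ ∪ K₂)ᶜ, μ y ≤ t + 1) :
    (mergeGraph G K₁ K₂ ρ μ).edgeSet.ncard
      + ∑ y ∈ (K₁ ∪ K₂)ᶜ, (degIn G y K₁ + degIn G y K₂) + ∑ a ∈ K₁, degIn G a K₂
      = G.edgeSet.ncard + ∑ y ∈ (K₁ ∪ K₂)ᶜ, μ y := by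
  have h1 := ncard_edgeSet_eq hd hK₁ hc₁ hK₂ hc₂
  have h2 := ncard_edgeSet_eq (G := mergeGraph G K₁ K₂ ρ μ) hd mergeGraph_clique_left hc₁
    mergeGraph_clique_right hc₂
  have h3 : ∑ y ∈ (K₁ ∪ K₂)ᶜ, degIn (mergeGraph G K₁ K₂ ρ μ) y (K₁ ∪ K₂)ᶜ
      = ∑ y ∈ (K₁ ∪ K₂)ᶜ, degIn G y (K₁ ∪ K₂)ᶜ :=
    Finset.sum_congr rfl fun y hy =>
      degIn_mergeGraph_of_disjoint disjoint_compl_left (Finset.mem_compl.1 hy)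
  have h4 : ∑ y ∈ (K₁ ∪ K₂)ᶜ, (degIn (mergeGraph G K₁ K₂ ρ μ) y K₁
      + degIn (mergeGraph G K₁ K₂ ρ μ) y K₂) = ∑ y ∈ (K₁ ∪ K₂)ᶜ, μ y := by
    refine Finset.sum_congr rfl fun y hy => ?_
    have hy' := Finset.mem_compl.1 hy
    rw [degIn_mergeGraph_left hρ hy' (by rw [hc₁]; exact hμ y hy),
      degIn_mergeGraph_right hd (fun h => hy' (Finset.mem_union_right _ h)), add_zero]
  have h5 : ∑ a ∈ K₁, degIn (mergeGraph G K₁ K₂ ρ μ) a K₂ = 0 :=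
    Finset.sum_eq_zero fun a ha => degIn_mergeGraph_right hd (Finset.disjoint_left.1 hd ha)
  rw [h3, h4, h5] at h2
  omega

/-- A comparison of the triangles at `y` before and after merging. The two sums in `hD` bound the
triangles that `y` forms with a neighbour outside the cliques and a vertex in them: because the
neighbourhoods in `K₁` are nested after merging, two vertices with `a` and `b` neighbours there
share `min a b` of them. -/
theorem triangleDegree_mergeGraph [Fintype V] (hd : Disjoint K₁ K₂)
    (hK₁ : ∀ a ∈ K₁, ∀ b ∈ K₁, a ≠ b → G.Adj a b) (hc₁ : K₁.card = t + 1)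
    (hK₂ : ∀ a ∈ K₂, ∀ b ∈ K₂, a ≠ b → G.Adj a b)
    (hρ : ∀ j ≤ K₁.card, (K₁.filter (fun k => ρ k < j)).card = j)
    {y : V} (hy : y ∉ K₁ ∪ K₂) (hμ : μ y ≤ t + 1) {D D' : ℕ}
    (hD : ∑ z ∈ (K₁ ∪ K₂)ᶜ.filter (G.Adj y), (min (degIn G y K₁) (degIn G z K₁)
        + min (degIn G y K₂) (degIn G z K₂)) + D'
      ≤ ∑ z ∈ (K₁ ∪ K₂)ᶜ.filter (G.Adj y), min (μ y) (μ z) + D) :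
    2 * triangleDegree G y + degIn G y K₁ + degIn G y K₂ + μ y * μ y + 2 * D' ≤
      2 * triangleDegree (mergeGraph G K₁ K₂ ρ μ) y + μ y + 2 * D
      + degIn G y K₁ * degIn G y K₁ + degIn G y K₂ * degIn G y K₂
      + 2 * trianglePairs G y K₁ K₂ := by
  have h1 := two_mul_triangleDegree_eq hd hK₁ hK₂ y
  have h2 := two_mul_triangleDegree_eq (G := mergeGraph G K₁ K₂ ρ μ) hd mergeGraph_clique_left
    mergeGraph_clique_right y
  have hy2 : y ∉ K₂ := fun h => hy (Finset.mem_union_right _ h)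
  have hμ' : μ y ≤ K₁.card := by rw [hc₁]; exact hμ
  have hfil : (K₁ ∪ K₂)ᶜ.filter ((mergeGraph G K₁ K₂ ρ μ).Adj y) = (K₁ ∪ K₂)ᶜ.filter (G.Adj y) :=
    Finset.filter_congr fun z hz => mergeGraph_adj_of_notMem hy (Finset.mem_compl.1 hz)
  have h3 : trianglePairs (mergeGraph G K₁ K₂ ρ μ) y (K₁ ∪ K₂)ᶜ (K₁ ∪ K₂)ᶜ
      = trianglePairs G y (K₁ ∪ K₂)ᶜ (K₁ ∪ K₂)ᶜ := by
    unfold trianglePairs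
    refine Finset.sum_congr rfl fun a ha => Finset.sum_congr rfl fun b hb => if_congr ?_ rfl rfl
    have ha := Finset.mem_compl.1 ha
    have hb := Finset.mem_compl.1 hb
    rw [mergeGraph_adj_of_notMem hy ha, mergeGraph_adj_of_notMem hy hb,
      mergeGraph_adj_of_notMem ha hb]
  have h4 : trianglePairs (mergeGraph G K₁ K₂ ρ μ) y K₁ K₂ = 0 := by
    have := trianglePairs_le_mul (mergeGraph G K₁ K₂ ρ μ) y K₁ K₂
    rw [degIn_mergeGraph_right hd hy2] at this
    omega
  have h5 : ∑ z ∈ (K₁ ∪ K₂)ᶜ.filter (G.Adj y), (codegIn (mergeGraph G K₁ K₂ ρ μ) y z K₁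
      + codegIn (mergeGraph G K₁ K₂ ρ μ) y z K₂)
      = ∑ z ∈ (K₁ ∪ K₂)ᶜ.filter (G.Adj y), min (μ y) (μ z) := by
    refine Finset.sum_congr rfl fun z hz => ?_
    have hz := Finset.mem_compl.1 (Finset.mem_filter.1 hz).1
    have h0 := (codegIn_le_min (mergeGraph G K₁ K₂ ρ μ) y z K₂).trans (min_le_left _ _)
    rw [degIn_mergeGraph_right hd hy2] at h0
    rw [codegIn_mergeGraph_left hρ hy hz hμ']
    omega
  have h6 : ∑ z ∈ (K₁ ∪ K₂)ᶜ.filter (G.Adj y), (codegIn G y z K₁ + codegIn G y z K₂)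
      ≤ ∑ z ∈ (K₁ ∪ K₂)ᶜ.filter (G.Adj y), (min (degIn G y K₁) (degIn G z K₁)
        + min (degIn G y K₂) (degIn G z K₂)) :=
    Finset.sum_le_sum fun z _ => add_le_add (codegIn_le_min _ _ _ _) (codegIn_le_min _ _ _ _)
  rw [hfil, h3, h4, h5, degIn_mergeGraph_left hρ hy hμ', degIn_mergeGraph_right hd hy2] at h2
  omega

end Merge

/-! ### Two cliques of the same height -/

section Pair
variable {G : SimpleGraph V} {K₁ K₂ : Finset V} {t : ℕ}

/-- In an extremal graph no edge joins `K₁` to `K₂`: merging with `μ y` the number of neighbours of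
`y` in both cliques loses no triangle at any vertex outside, and deletes the edges between them. -/
theorem not_adj_of_minimal (hd : Disjoint K₁ K₂)
    (hK₁ : ∀ a ∈ K₁, ∀ b ∈ K₁, a ≠ b → G.Adj a b) (hc₁ : K₁.card = t + 1)
    (hK₂ : ∀ a ∈ K₂, ∀ b ∈ K₂, a ≠ b → G.Adj a b) (hc₂ : K₂.card = t + 1)
    (hG : IsExtremal G t) (hs : ∀ y ∉ K₁ ∪ K₂, degIn G y K₁ + degIn G y K₂ ≤ t + 1) :
    ∀ a ∈ K₁, ∀ b ∈ K₂, ¬ G.Adj a b := by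
  obtain ⟨ρ, hρ⟩ := exists_rank K₁
  have hM : TriangleCondition (mergeGraph G K₁ K₂ ρ (fun y => degIn G y K₁ + degIn G y K₂)) t := by
    intro y
    by_cases h1 : y ∈ K₁
    · exact choose_le_triangleDegree_of_clique mergeGraph_clique_left hc₁.ge h1
    by_cases h2 : y ∈ K₂
    · exact choose_le_triangleDegree_of_clique mergeGraph_clique_right hc₂.ge h2
    have hy : y ∉ K₁ ∪ K₂ := by simp [h1, h2]
    have h := triangleDegree_mergeGraph (μ := fun y => degIn G y K₁ + degIn G y K₂)
      hd hK₁ hc₁ hK₂ hρ hy (hs y hy) (D := 0) (D' := 0) (by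
        rw [add_zero, add_zero]
        refine Finset.sum_le_sum fun z _ => ?_
        omega)
    have h3 := trianglePairs_le_mul G y K₁ K₂
    refine (hG.1 y).trans ?_
    nlinarith
  have h1 := hG.2 _ hM
  have h2 := ncard_edgeSet_mergeGraph (μ := fun y => degIn G y K₁ + degIn G y K₂)
    hd hK₁ hc₁ hK₂ hc₂ hρ (fun y hy => hs y (Finset.mem_compl.1 hy))
  have h3 : ∑ a ∈ K₁, degIn G a K₂ = 0 := by omega
  intro a ha b hb hab
  have h4 := Finset.sum_eq_zero_iff.1 h3 a ha
  rw [degIn, Finset.card_eq_zero, Finset.filter_eq_empty_iff] at h4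
  exact h4 hb hab

theorem sum_ite_filter_eq_degIn {V : Type*} (G : SimpleGraph V) (y : V) {A B : Finset V}
    (h : B ⊆ A) : ∑ z ∈ A.filter (G.Adj y), (if z ∈ B then 1 else 0) = degIn G y B := by
  rw [← Finset.card_filter, degIn]
  congr 1
  ext z
  simp only [Finset.mem_filter]
  constructor
  · rintro ⟨⟨_, h1⟩, h2⟩
    exact ⟨h2, h1⟩
  · rintro ⟨h1, h2⟩
    exact ⟨⟨h h1, h2⟩, h1⟩

/-- The vertices outside the two cliques with `g + 1` neighbours in them. -/
noncomputable def topLevel (G : SimpleGraph V) (K₁ K₂ : Finset V) (g : ℕ) : Finset V :=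
  (K₁ ∪ K₂)ᶜ.filter (fun y => degIn G y K₁ + degIn G y K₂ = g + 1)

/-- The merged graph in which no vertex outside keeps more than `g` neighbours in `K₁`. -/
noncomputable def cappedMerge (G : SimpleGraph V) (K₁ K₂ : Finset V) (ρ : V → ℕ) (g : ℕ) :
    SimpleGraph V :=
  mergeGraph G K₁ K₂ ρ (fun y => min (degIn G y K₁ + degIn G y K₂) g)

theorem mem_topLevel {g : ℕ} {y : V} :
    y ∈ topLevel G K₁ K₂ g ↔ y ∉ K₁ ∪ K₂ ∧ degIn G y K₁ + degIn G y K₂ = g + 1 := by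
  rw [topLevel, Finset.mem_filter, Finset.mem_compl]

theorem topLevel_subset {g : ℕ} : topLevel G K₁ K₂ g ⊆ (K₁ ∪ K₂)ᶜ := Finset.filter_subset _ _

section Capped
variable {ρ : V → ℕ} {g : ℕ}

/-- Capping at `g`, one below the largest number of neighbours in the cliques, saves exactly one
edge for each top-level vertex. -/
theorem ncard_edgeSet_cappedMerge (hd : Disjoint K₁ K₂)
    (hK₁ : ∀ a ∈ K₁, ∀ b ∈ K₁, a ≠ b → G.Adj a b) (hc₁ : K₁.card = t + 1)
    (hK₂ : ∀ a ∈ K₂, ∀ b ∈ K₂, a ≠ b → G.Adj a b) (hc₂ : K₂.card = t + 1)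
    (hρ : ∀ j ≤ K₁.card, (K₁.filter (fun k => ρ k < j)).card = j) (hg : g ≤ t + 1)
    (hno : ∀ a ∈ K₁, ∀ b ∈ K₂, ¬ G.Adj a b)
    (hle : ∀ y ∉ K₁ ∪ K₂, degIn G y K₁ + degIn G y K₂ ≤ g + 1) :
    (cappedMerge G K₁ K₂ ρ g).edgeSet.ncard + (topLevel G K₁ K₂ g).card = G.edgeSet.ncard := by
  have hcross : ∑ a ∈ K₁, degIn G a K₂ = 0 := by
    refine Finset.sum_eq_zero fun a ha => ?_
    rw [degIn, Finset.card_eq_zero, Finset.filter_eq_empty_iff]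
    exact fun b hb => hno a ha b hb
  have hsum : ∑ y ∈ (K₁ ∪ K₂)ᶜ, (degIn G y K₁ + degIn G y K₂)
      = ∑ y ∈ (K₁ ∪ K₂)ᶜ, min (degIn G y K₁ + degIn G y K₂) g + (topLevel G K₁ K₂ g).card := by
    rw [topLevel, Finset.card_filter, ← Finset.sum_add_distrib]
    refine Finset.sum_congr rfl fun y hy => ?_
    have := hle y (Finset.mem_compl.1 hy)
    split_ifs <;> omega
  have := ncard_edgeSet_mergeGraph (ρ := ρ)
    (μ := fun y => min (degIn G y K₁ + degIn G y K₂) g) hd hK₁ hc₁ hK₂ hc₂ hρ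
    (fun y _ => (min_le_right _ _).trans hg)
  rw [hcross] at this
  rw [cappedMerge]
  omega

theorem degIn_cappedMerge {A : Finset V} (hA : A ⊆ (K₁ ∪ K₂)ᶜ) {y : V} (hy : y ∉ K₁ ∪ K₂) :
    degIn (cappedMerge G K₁ K₂ ρ g) y A = degIn G y A :=
  degIn_mergeGraph_of_disjoint (disjoint_compl_left.mono_left hA) hy

theorem le_degIn_cappedMerge (hd : Disjoint K₁ K₂) (hc₁ : K₁.card = t + 1)
    (hρ : ∀ j ≤ K₁.card, (K₁.filter (fun k => ρ k < j)).card = j) (hg : g ≤ t + 1)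
    (hhigh : ∀ y ∉ K₁ ∪ K₂, (∃ k ∈ K₁ ∪ K₂, G.Adj y k) → t + 1 ≤ degIn G y Finset.univ)
    {y : V} (hy : y ∈ topLevel G K₁ K₂ g) :
    t ≤ degIn (cappedMerge G K₁ K₂ ρ g) y Finset.univ := by
  obtain ⟨hyR, hsy⟩ := mem_topLevel.1 hy
  have h1 : t + 1 ≤ degIn G y Finset.univ := by
    apply hhigh y hyR
    by_contra hn
    push Not at hn
    have h2 : ∀ K ⊆ K₁ ∪ K₂, degIn G y K = 0 := by
      intro K hK
      rw [degIn, Finset.card_eq_zero, Finset.filter_eq_empty_iff]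
      exact fun b hb => hn b (hK hb)
    have h3 := h2 K₁ Finset.subset_union_left
    have h4 := h2 K₂ Finset.subset_union_right
    omega
  rw [degIn_univ_eq G hd] at h1
  rw [degIn_univ_eq _ hd, degIn_cappedMerge subset_rfl hyR, cappedMerge,
    degIn_mergeGraph_left hρ hyR (by rw [hc₁]; exact (min_le_right _ _).trans hg)]
  omega

theorem trianglePairs_eq_zero {V : Type*} {G : SimpleGraph V} {A B : Finset V}
    (hno : ∀ a ∈ A, ∀ b ∈ B, ¬ G.Adj a b) (y : V) : trianglePairs G y A B = 0 :=
  Finset.sum_eq_zero fun a ha => Finset.sum_eq_zero fun b hb => if_neg fun h => hno a ha b hb h.2.2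

theorem choose_le_triangleDegree_cappedMerge (hd : Disjoint K₁ K₂)
    (hK₁ : ∀ a ∈ K₁, ∀ b ∈ K₁, a ≠ b → G.Adj a b) (hc₁ : K₁.card = t + 1)
    (hK₂ : ∀ a ∈ K₂, ∀ b ∈ K₂, a ≠ b → G.Adj a b) (hc₂ : K₂.card = t + 1)
    (hρ : ∀ j ≤ K₁.card, (K₁.filter (fun k => ρ k < j)).card = j) (hg : g ≤ t + 1)
    (hno : ∀ a ∈ K₁, ∀ b ∈ K₂, ¬ G.Adj a b)
    (hle : ∀ y ∉ K₁ ∪ K₂, degIn G y K₁ + degIn G y K₂ ≤ g + 1) (hG : TriangleCondition G t)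
    {y : V} (hyT : y ∉ topLevel G K₁ K₂ g) :
    t.choose 2 ≤ triangleDegree (cappedMerge G K₁ K₂ ρ g) y := by
  by_cases h1 : y ∈ K₁
  · exact choose_le_triangleDegree_of_clique mergeGraph_clique_left hc₁.ge h1
  by_cases h2 : y ∈ K₂
  · exact choose_le_triangleDegree_of_clique mergeGraph_clique_right hc₂.ge h2
  have hy : y ∉ K₁ ∪ K₂ := by simp [h1, h2]
  have hsy : degIn G y K₁ + degIn G y K₂ ≤ g := by
    have h3 : ¬ (degIn G y K₁ + degIn G y K₂ = g + 1) := fun h => hyT (mem_topLevel.2 ⟨hy, h⟩)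
    have h4 := hle y hy
    omega
  have h := triangleDegree_mergeGraph (ρ := ρ)
    (μ := fun y => min (degIn G y K₁ + degIn G y K₂) g)
    hd hK₁ hc₁ hK₂ hρ hy ((min_le_right _ _).trans hg) (D := 0) (D' := 0) (by
      rw [add_zero, add_zero]
      refine Finset.sum_le_sum fun z _ => ?_
      omega)
  rw [trianglePairs_eq_zero hno, min_eq_left hsy] at h
  refine (hG y).trans ?_
  rw [cappedMerge]
  nlinarith

/-- A top-level vertex with `m₁, m₂ > 0` neighbours in the two cliques gains `m₁ * m₂ ≥ g` triangles
from merging them and loses `g` to the cap, so it is short only through its neighbours in `A`. -/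
theorem triangleDegree_cappedMerge_both (hd : Disjoint K₁ K₂)
    (hK₁ : ∀ a ∈ K₁, ∀ b ∈ K₁, a ≠ b → G.Adj a b) (hc₁ : K₁.card = t + 1)
    (hK₂ : ∀ a ∈ K₂, ∀ b ∈ K₂, a ≠ b → G.Adj a b)
    (hρ : ∀ j ≤ K₁.card, (K₁.filter (fun k => ρ k < j)).card = j) (hg : g ≤ t + 1)
    (hno : ∀ a ∈ K₁, ∀ b ∈ K₂, ¬ G.Adj a b)
    (hle : ∀ y ∉ K₁ ∪ K₂, degIn G y K₁ + degIn G y K₂ ≤ g + 1)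
    {A : Finset V} (hA : ∀ y, y ∈ A ↔ y ∈ topLevel G K₁ K₂ g ∧
      degIn G y K₁ ≠ 0 ∧ degIn G y K₂ ≠ 0) {y : V} (hy : y ∈ A) :
    triangleDegree G y ≤ triangleDegree (cappedMerge G K₁ K₂ ρ g) y
      + degIn (cappedMerge G K₁ K₂ ρ g) y A := by
  obtain ⟨hyT, hy1, hy2⟩ := (hA y).1 hy
  obtain ⟨hyR, hsy⟩ := mem_topLevel.1 hyT
  have hAR : A ⊆ (K₁ ∪ K₂)ᶜ := fun z hz => topLevel_subset ((hA z).1 hz).1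
  have hμy : min (degIn G y K₁ + degIn G y K₂) g = g := by omega
  have h := triangleDegree_mergeGraph (ρ := ρ)
    (μ := fun y => min (degIn G y K₁ + degIn G y K₂) g)
    hd hK₁ hc₁ hK₂ hρ hyR ((min_le_right _ _).trans hg) (D := degIn G y A) (D' := 0) (by
      rw [add_zero, ← sum_ite_filter_eq_degIn G y hAR, ← Finset.sum_add_distrib]
      refine Finset.sum_le_sum fun z hz => ?_
      have hz := Finset.mem_compl.1 (Finset.mem_filter.1 hz).1
      have hsz := hle z hz
      rw [hμy]
      split_ifs with hc <;> rw [hA, mem_topLevel, and_iff_right hz] at hc <;> omega)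
  rw [trianglePairs_eq_zero hno, hμy] at h
  rw [degIn_cappedMerge hAR hyR, cappedMerge]
  obtain ⟨p, hp⟩ : ∃ p, degIn G y K₁ = p + 1 := ⟨degIn G y K₁ - 1, by omega⟩
  obtain ⟨q, hq⟩ : ∃ q, degIn G y K₂ = q + 1 := ⟨degIn G y K₂ - 1, by omega⟩
  obtain rfl : g = p + q + 1 := by omega
  rw [hp, hq] at h
  nlinarith

/-- A top-level vertex that sees only one of the cliques loses `g` triangles inside the clique to
the cap, and one for each neighbour of the same kind. -/
theorem triangleDegree_cappedMerge_one {K K' : Finset V} (hd : Disjoint K₁ K₂)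
    (hKK : K = K₁ ∧ K' = K₂ ∨ K = K₂ ∧ K' = K₁)
    (hK₁ : ∀ a ∈ K₁, ∀ b ∈ K₁, a ≠ b → G.Adj a b) (hc₁ : K₁.card = t + 1)
    (hK₂ : ∀ a ∈ K₂, ∀ b ∈ K₂, a ≠ b → G.Adj a b)
    (hρ : ∀ j ≤ K₁.card, (K₁.filter (fun k => ρ k < j)).card = j) (hg : g ≤ t + 1)
    (hno : ∀ a ∈ K₁, ∀ b ∈ K₂, ¬ G.Adj a b)
    (hle : ∀ y ∉ K₁ ∪ K₂, degIn G y K₁ + degIn G y K₂ ≤ g + 1)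
    {A : Finset V} (hA : ∀ y, y ∈ A ↔ y ∈ topLevel G K₁ K₂ g ∧ degIn G y K' = 0)
    {y : V} (hy : y ∈ A) :
    triangleDegree G y ≤ triangleDegree (cappedMerge G K₁ K₂ ρ g) y
      + degIn (cappedMerge G K₁ K₂ ρ g) y A + g := by
  obtain ⟨hyT, hy1⟩ := (hA y).1 hy
  obtain ⟨hyR, hsy⟩ := mem_topLevel.1 hyT
  have hAR : A ⊆ (K₁ ∪ K₂)ᶜ := fun z hz => topLevel_subset ((hA z).1 hz).1
  have hμy : min (degIn G y K₁ + degIn G y K₂) g = g := by omega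
  have h := triangleDegree_mergeGraph (ρ := ρ)
    (μ := fun y => min (degIn G y K₁ + degIn G y K₂) g)
    hd hK₁ hc₁ hK₂ hρ hyR ((min_le_right _ _).trans hg) (D := degIn G y A) (D' := 0) (by
      rw [add_zero, ← sum_ite_filter_eq_degIn G y hAR, ← Finset.sum_add_distrib]
      refine Finset.sum_le_sum fun z hz => ?_
      have hz := Finset.mem_compl.1 (Finset.mem_filter.1 hz).1
      have hsz := hle z hz
      rw [hμy]
      rcases hKK with ⟨rfl, rfl⟩ | ⟨rfl, rfl⟩ <;>
      split_ifs with hc <;> rw [hA, mem_topLevel, and_iff_right hz] at hc <;> omega)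
  rw [trianglePairs_eq_zero hno, hμy] at h
  rw [degIn_cappedMerge hAR hyR, cappedMerge]
  rcases hKK with ⟨rfl, rfl⟩ | ⟨rfl, rfl⟩
  · rw [hy1, show degIn G y K = g + 1 by omega] at h
    linarith
  · rw [hy1, show degIn G y K = g + 1 by omega] at h
    linarith

/-- A top-level vertex that sees only `K` regains `g` triangles if it is adjacent to a top-level
vertex `x` that sees only `K'`, because after merging it shares `g` neighbours in `K₁` with `x`. -/
theorem triangleDegree_cappedMerge_one_of_adj {K K' : Finset V} (hd : Disjoint K₁ K₂)
    (hKK : K = K₁ ∧ K' = K₂ ∨ K = K₂ ∧ K' = K₁)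
    (hK₁ : ∀ a ∈ K₁, ∀ b ∈ K₁, a ≠ b → G.Adj a b) (hc₁ : K₁.card = t + 1)
    (hK₂ : ∀ a ∈ K₂, ∀ b ∈ K₂, a ≠ b → G.Adj a b)
    (hρ : ∀ j ≤ K₁.card, (K₁.filter (fun k => ρ k < j)).card = j) (hg : g ≤ t + 1)
    (hno : ∀ a ∈ K₁, ∀ b ∈ K₂, ¬ G.Adj a b)
    (hle : ∀ y ∉ K₁ ∪ K₂, degIn G y K₁ + degIn G y K₂ ≤ g + 1)
    {A : Finset V} (hA : ∀ y, y ∈ A ↔ y ∈ topLevel G K₁ K₂ g ∧ degIn G y K' = 0)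
    {y : V} (hy : y ∈ A) {x : V} (hx : x ∈ topLevel G K₁ K₂ g) (hxK : degIn G x K = 0)
    (hyx : (cappedMerge G K₁ K₂ ρ g).Adj y x) :
    triangleDegree G y ≤ triangleDegree (cappedMerge G K₁ K₂ ρ g) y
      + degIn (cappedMerge G K₁ K₂ ρ g) y A := by
  obtain ⟨hyT, hy1⟩ := (hA y).1 hy
  obtain ⟨hyR, hsy⟩ := mem_topLevel.1 hyT
  obtain ⟨hxR, hsx⟩ := mem_topLevel.1 hx
  rw [cappedMerge, mergeGraph_adj_of_notMem hyR hxR] at hyx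
  have hAR : A ⊆ (K₁ ∪ K₂)ᶜ := fun z hz => topLevel_subset ((hA z).1 hz).1
  have hμy : min (degIn G y K₁ + degIn G y K₂) g = g := by omega
  have hind : ∑ z ∈ (K₁ ∪ K₂)ᶜ.filter (G.Adj y), (if z = x then g else 0) = g := by
    rw [Finset.sum_ite_eq', if_pos (Finset.mem_filter.2 ⟨Finset.mem_compl.2 hxR, hyx⟩)]
  have h := triangleDegree_mergeGraph (ρ := ρ)
    (μ := fun y => min (degIn G y K₁ + degIn G y K₂) g)
    hd hK₁ hc₁ hK₂ hρ hyR ((min_le_right _ _).trans hg) (D := degIn G y A)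
    (D' := ∑ z ∈ (K₁ ∪ K₂)ᶜ.filter (G.Adj y), (if z = x then g else 0)) (by
      rw [← sum_ite_filter_eq_degIn G y hAR, ← Finset.sum_add_distrib, ← Finset.sum_add_distrib]
      refine Finset.sum_le_sum fun z hz => ?_
      have hz := Finset.mem_compl.1 (Finset.mem_filter.1 hz).1
      have hsz := hle z hz
      rw [hμy]
      by_cases hzx : z = x
      · subst hzx
        rw [if_pos rfl]
        rcases hKK with ⟨rfl, rfl⟩ | ⟨rfl, rfl⟩ <;> omega
      · rw [if_neg hzx]
        rcases hKK with ⟨rfl, rfl⟩ | ⟨rfl, rfl⟩ <;>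
        split_ifs with hc <;> rw [hA, mem_topLevel, and_iff_right hz] at hc <;> omega)
  rw [trianglePairs_eq_zero hno, hμy, hind] at h
  rw [degIn_cappedMerge hAR hyR, cappedMerge]
  rcases hKK with ⟨rfl, rfl⟩ | ⟨rfl, rfl⟩
  · rw [hy1, show degIn G y K = g + 1 by omega] at h
    linarith
  · rw [hy1, show degIn G y K = g + 1 by omega] at h
    linarith

end Capped

theorem exists_repair_or_empty {t : ℕ} (U : Finset V) (G : SimpleGraph V)
    (hsz : 2 * U.card ≤ t + 2) (hdeg : ∀ u ∈ U, t ≤ degIn G u Finset.univ)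
    (htri : ∀ u ∈ U, t.choose 2 ≤ triangleDegree G u + degIn G u U) :
    ∃ H, G ≤ H ∧ H.edgeSet.ncard ≤ G.edgeSet.ncard + U.card ∧
      ∀ u ∈ U, t.choose 2 ≤ triangleDegree H u := by
  rcases U.eq_empty_or_nonempty with he | hne
  · exact ⟨G, le_rfl, by omega, by simp [he]⟩
  · obtain ⟨H, hH, hHc, hHt⟩ := exists_repair (t := t) U G hne hsz hdeg htri
    exact ⟨H, hH, by omega, hHt⟩

/-- The largest number of neighbours that an outside vertex has in a clique cannot be the same for
two such cliques: the capped merge saves one edge per top-level vertex, and fewer new edges repair all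
top-level vertices. -/
theorem false_of_same_height (hd : Disjoint K₁ K₂)
    (hK₁ : ∀ a ∈ K₁, ∀ b ∈ K₁, a ≠ b → G.Adj a b) (hc₁ : K₁.card = t + 1)
    (hK₂ : ∀ a ∈ K₂, ∀ b ∈ K₂, a ≠ b → G.Adj a b) (hc₂ : K₂.card = t + 1)
    (hG : IsExtremal G t)
    (hhigh : ∀ y ∉ K₁ ∪ K₂, (∃ k ∈ K₁ ∪ K₂, G.Adj y k) → t + 1 ≤ degIn G y Finset.univ)
    (hs : 2 * ∑ y ∈ (K₁ ∪ K₂)ᶜ, (degIn G y K₁ + degIn G y K₂) ≤ t + 2)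
    {h : ℕ} (hh : 1 ≤ h)
    (hle₁ : ∀ y ∉ K₁, degIn G y K₁ ≤ h) (hle₂ : ∀ y ∉ K₂, degIn G y K₂ ≤ h)
    (hex₁ : ∃ y ∉ K₁, degIn G y K₁ = h) (hex₂ : ∃ y ∉ K₂, degIn G y K₂ = h) : False := by
  have hsR : ∀ y ∉ K₁ ∪ K₂, 2 * (degIn G y K₁ + degIn G y K₂) ≤ t + 2 := fun y hy => by
    have := Finset.single_le_sum (f := fun y => degIn G y K₁ + degIn G y K₂)
      (fun _ _ => Nat.zero_le _) (Finset.mem_compl.2 hy)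
    omega
  have hno := not_adj_of_minimal hd hK₁ hc₁ hK₂ hc₂ hG
    (fun y hy => by have := hsR y hy; omega)
  have hpos : ∀ y (K : Finset V), 1 ≤ degIn G y K → ∃ k ∈ K, G.Adj y k := by
    intro y K hy
    obtain ⟨k, hk⟩ := Finset.card_pos.1 hy
    exact ⟨k, (Finset.mem_filter.1 hk).1, (Finset.mem_filter.1 hk).2⟩
  obtain ⟨y₁, hy₁K, hy₁⟩ := hex₁
  obtain ⟨y₂, hy₂K, hy₂⟩ := hex₂
  have hy₁R : y₁ ∉ K₁ ∪ K₂ := by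
    rw [Finset.mem_union, not_or]
    refine ⟨hy₁K, fun h2 => ?_⟩
    obtain ⟨k, hk, hadj⟩ := hpos y₁ K₁ (by omega)
    exact hno k hk y₁ h2 hadj.symm
  have hy₂R : y₂ ∉ K₁ ∪ K₂ := by
    rw [Finset.mem_union, not_or]
    refine ⟨fun h2 => ?_, hy₂K⟩
    obtain ⟨k, hk, hadj⟩ := hpos y₂ K₂ (by omega)
    exact hno y₂ h2 k hk hadj
  -- the largest number `g + 1` of neighbours in the two cliques together
  obtain ⟨y₀, hy₀R, hmax⟩ := Finset.exists_max_image (K₁ ∪ K₂)ᶜ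
    (fun y => degIn G y K₁ + degIn G y K₂) ⟨y₁, Finset.mem_compl.2 hy₁R⟩
  have hy₁m := hmax y₁ (Finset.mem_compl.2 hy₁R)
  have hy₀s := hsR y₀ (Finset.mem_compl.1 hy₀R)
  obtain ⟨g, hg⟩ : ∃ g, degIn G y₀ K₁ + degIn G y₀ K₂ = g + 1 :=
    ⟨degIn G y₀ K₁ + degIn G y₀ K₂ - 1, by omega⟩
  have hle : ∀ y ∉ K₁ ∪ K₂, degIn G y K₁ + degIn G y K₂ ≤ g + 1 := fun y hy =>
    (hmax y (Finset.mem_compl.2 hy)).trans hg.le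
  have hg1 : g ≤ t + 1 := by omega
  have hTc : 2 * (topLevel G K₁ K₂ g).card ≤ t + 2 := by
    have : (topLevel G K₁ K₂ g).card ≤ ∑ y ∈ (K₁ ∪ K₂)ᶜ, (degIn G y K₁ + degIn G y K₂) := by
      rw [topLevel, Finset.card_filter]
      refine Finset.sum_le_sum fun y _ => ?_
      split_ifs <;> omega
    omega
  obtain ⟨ρ, hρ⟩ := exists_rank K₁
  have hMe := ncard_edgeSet_cappedMerge hd hK₁ hc₁ hK₂ hc₂ hρ hg1 hno hle
  have hMdeg : ∀ y ∈ topLevel G K₁ K₂ g, t ≤ degIn (cappedMerge G K₁ K₂ ρ g) y Finset.univ :=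
    fun y hy => le_degIn_cappedMerge hd hc₁ hρ hg1 hhigh hy
  have hMsat : ∀ y ∉ topLevel G K₁ K₂ g, t.choose 2 ≤ triangleDegree (cappedMerge G K₁ K₂ ρ g) y :=
    fun y hy => choose_le_triangleDegree_cappedMerge hd hK₁ hc₁ hK₂ hc₂ hρ hg1 hno hle hG.1 hy
  obtain ⟨T₀, hT₀⟩ : ∃ A : Finset V, ∀ y, y ∈ A ↔ y ∈ topLevel G K₁ K₂ g ∧
      degIn G y K₁ ≠ 0 ∧ degIn G y K₂ ≠ 0 :=
    ⟨_, fun y => Finset.mem_filter⟩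
  have hT₀T : T₀ ⊆ topLevel G K₁ K₂ g := fun y hy => ((hT₀ y).1 hy).1
  have hloss₀ := fun y (hy : y ∈ T₀) => (hG.1 y).trans
    (triangleDegree_cappedMerge_both hd hK₁ hc₁ hK₂ hρ hg1 hno hle hT₀ hy)
  have hT₀c := Finset.card_le_card hT₀T
  by_cases hcase : h = g + 1
  · -- some top-level vertices see only `K₁` and some only `K₂`
    obtain ⟨T₁, hT₁⟩ : ∃ A : Finset V, ∀ y, y ∈ A ↔ y ∈ topLevel G K₁ K₂ g ∧
      degIn G y K₂ = 0 := ⟨_, fun y => Finset.mem_filter⟩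
    obtain ⟨T₂, hT₂⟩ : ∃ A : Finset V, ∀ y, y ∈ A ↔ y ∈ topLevel G K₁ K₂ g ∧
      degIn G y K₁ = 0 := ⟨_, fun y => Finset.mem_filter⟩
    have hT₁T : T₁ ⊆ topLevel G K₁ K₂ g := fun y hy => ((hT₁ y).1 hy).1
    have hT₂T : T₂ ⊆ topLevel G K₁ K₂ g := fun y hy => ((hT₂ y).1 hy).1
    have hT₁₂ : Disjoint T₁ T₂ := by
      rw [Finset.disjoint_left]
      intro a ha hb
      have h1 := (mem_topLevel.1 (hT₁T ha)).2
      have h2 := ((hT₁ a).1 ha).2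
      have h3 := ((hT₂ a).1 hb).2
      omega
    have hcard : T₁.card + T₂.card + T₀.card ≤ (topLevel G K₁ K₂ g).card := by
      rw [← Finset.card_union_of_disjoint hT₁₂, ← Finset.card_union_of_disjoint]
      · exact Finset.card_le_card (Finset.union_subset (Finset.union_subset hT₁T hT₂T) hT₀T)
      · rw [Finset.disjoint_left]
        intro a ha hb
        have h2 := ((hT₀ a).1 hb).2
        rcases Finset.mem_union.1 ha with ha | ha
        · exact h2.2 ((hT₁ a).1 ha).2
        · exact h2.1 ((hT₂ a).1 ha).2
    have hy₁T : y₁ ∈ T₁ := by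
      have h1 := hle y₁ hy₁R
      exact (hT₁ y₁).2 ⟨mem_topLevel.2 ⟨hy₁R, by omega⟩, by omega⟩
    have hy₂T : y₂ ∈ T₂ := by
      have h1 := hle y₂ hy₂R
      exact (hT₂ y₂).2 ⟨mem_topLevel.2 ⟨hy₂R, by omega⟩, by omega⟩
    obtain ⟨H₁, hH₁, hHc₁, hHt₁⟩ := exists_repair_pair (t := t) (a := g)
      (G := cappedMerge G K₁ K₂ ρ g)
      ⟨y₁, hy₁T⟩ ⟨y₂, hy₂T⟩ hT₁₂ (by omega) (by omega)
      (fun x hx => hMdeg x (hT₁T hx)) (fun x hx => hMdeg x (hT₂T hx))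
      (fun y hy => (hG.1 y).trans (triangleDegree_cappedMerge_one hd (Or.inl ⟨rfl, rfl⟩)
        hK₁ hc₁ hK₂ hρ hg1 hno hle hT₁ hy))
      (fun y hy ⟨x, hx, hyx⟩ => (hG.1 y).trans
        (triangleDegree_cappedMerge_one_of_adj hd (Or.inl ⟨rfl, rfl⟩)
        hK₁ hc₁ hK₂ hρ hg1 hno hle hT₁ hy (hT₂T hx) ((hT₂ x).1 hx).2 hyx))
      (fun y hy => (hG.1 y).trans (triangleDegree_cappedMerge_one hd (Or.inr ⟨rfl, rfl⟩)
        hK₁ hc₁ hK₂ hρ hg1 hno hle hT₂ hy))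
      (fun y hy ⟨x, hx, hyx⟩ => (hG.1 y).trans
        (triangleDegree_cappedMerge_one_of_adj hd (Or.inr ⟨rfl, rfl⟩)
        hK₁ hc₁ hK₂ hρ hg1 hno hle hT₂ hy (hT₁T hx) ((hT₁ x).1 hx).2 hyx)) (by
        intro x hx y hy
        refine ⟨K₁.filter (fun k => ρ k < g), hρ g (by omega), ?_, ?_⟩
        · rw [Finset.disjoint_left]
          intro k hk hk'
          have hkR := topLevel_subset (Finset.union_subset hT₁T hT₂T hk')
          exact Finset.mem_compl.1 hkR (Finset.mem_union_left _ (Finset.mem_filter.1 hk).1)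
        · intro k hk
          obtain ⟨hk, hkg⟩ := Finset.mem_filter.1 hk
          obtain ⟨hxR, h1⟩ := mem_topLevel.1 (hT₁T hx)
          obtain ⟨hyR, h2⟩ := mem_topLevel.1 (hT₂T hy)
          rw [cappedMerge, mergeGraph_adj_left hxR hk, mergeGraph_adj_left hyR hk]
          omega)
    obtain ⟨H, hH, hHc, hHt⟩ := exists_repair_or_empty (t := t) T₀ H₁ (by omega)
      (fun u hu => (hMdeg u (hT₀T hu)).trans (degIn_mono hH₁ _ _))
      (fun u hu => (hloss₀ u hu).trans
        (add_le_add (triangleDegree_mono hH₁ u) (degIn_mono hH₁ _ _)))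
    have := hG.2 H (fun v => by
      by_cases hv : v ∈ topLevel G K₁ K₂ g
      · by_cases h1 : degIn G v K₁ = 0
        · exact (hHt₁ v (Finset.mem_union_right _ ((hT₂ v).2 ⟨hv, h1⟩))).trans
            (triangleDegree_mono hH v)
        by_cases h2 : degIn G v K₂ = 0
        · exact (hHt₁ v (Finset.mem_union_left _ ((hT₁ v).2 ⟨hv, h2⟩))).trans
            (triangleDegree_mono hH v)
        exact hHt v ((hT₀ v).2 ⟨hv, h1, h2⟩)
      · exact (hMsat v hv).trans (triangleDegree_mono (hH₁.trans hH) v))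
    omega
  · -- every top-level vertex sees both cliques
    have hTT₀ : ∀ y ∈ topLevel G K₁ K₂ g, y ∈ T₀ := by
      intro y hy
      obtain ⟨hyR, h1⟩ := mem_topLevel.1 hy
      have h2 := hle₁ y (fun h => hyR (Finset.mem_union_left _ h))
      have h3 := hle₂ y (fun h => hyR (Finset.mem_union_right _ h))
      exact (hT₀ y).2 ⟨hy, by omega, by omega⟩
    obtain ⟨H, hH, hHc, hHt⟩ := exists_repair (t := t) T₀ (cappedMerge G K₁ K₂ ρ g)
      ⟨y₀, hTT₀ y₀ (mem_topLevel.2 ⟨Finset.mem_compl.1 hy₀R, hg⟩)⟩ (by omega)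
      (fun u hu => hMdeg u (hT₀T hu)) hloss₀
    have := hG.2 H (fun v => by
      by_cases hv : v ∈ topLevel G K₁ K₂ g
      · exact hHt v (hTT₀ v hv)
      · exact (hMsat v hv).trans (triangleDegree_mono hH v))
    omega

end Pair

/-! ### The comparison graph -/

theorem card_filter_index_mem {n : ℕ} (φ : V ≃ Fin n) {S : Finset ℕ} (hS : S ⊆ Finset.range n) :
    (Finset.univ.filter (fun v => (φ v : ℕ) ∈ S)).card = S.card := by
  refine Finset.card_bij (fun v _ => (φ v : ℕ)) ?_ ?_ ?_
  · intro v hv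
    exact (Finset.mem_filter.1 hv).2
  · intro a _ b _ hab
    exact φ.injective (Fin.ext hab)
  · intro i hi
    refine ⟨φ.symm ⟨i, Finset.mem_range.1 (hS hi)⟩, ?_, by simp⟩
    simp [hi]

/-- The comparison graph. With `Fintype.card V = q * (t + 1) + r` the vertices are placed in a row,
and `q` consecutive blocks of `t + 1` vertices and the block of the last `t + 1` vertices are made
complete. Only the `t + 1 - r` vertices in the overlap of the last two blocks have degree above `t`,
namely `t + r`, and `4 * r * (t + 1 - r) ≤ (t + 1) ^ 2`. -/
theorem exists_blocks_graph (t : ℕ) (hn : t + 1 ≤ Fintype.card V) :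
    ∃ H : SimpleGraph V, TriangleCondition H t ∧
      4 * ∑ v, degIn H v Finset.univ ≤ 4 * (t * Fintype.card V) + (t + 1) ^ 2 := by
  obtain ⟨n, hnV⟩ : ∃ n, n = Fintype.card V := ⟨_, rfl⟩
  rw [← hnV] at hn ⊢
  obtain ⟨φ⟩ : Nonempty (V ≃ Fin n) := ⟨Fintype.equivFinOfCardEq hnV.symm⟩
  have htpos : 0 < t + 1 := Nat.succ_pos t
  obtain ⟨q, hq⟩ : ∃ q, q = n / (t + 1) := ⟨_, rfl⟩
  obtain ⟨r, hr⟩ : ∃ r, r = n % (t + 1) := ⟨_, rfl⟩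
  have hnqr : (t + 1) * q + r = n := by rw [hq, hr]; exact Nat.div_add_mod n (t + 1)
  have hrt : r < t + 1 := by rw [hr]; exact Nat.mod_lt _ htpos
  obtain ⟨p, rfl⟩ : ∃ p, q = p + 1 := by
    refine ⟨q - 1, (Nat.sub_add_cancel ?_).symm⟩
    rw [hq]
    exact Nat.div_pos hn htpos
  -- the intervals that carry the cliques
  let I : ℕ → Finset ℕ := fun k => Finset.Ico ((t + 1) * k) ((t + 1) * k + (t + 1))
  let L : Finset ℕ := Finset.Ico (n - (t + 1)) n
  have hI : ∀ k i, i ∈ I k ↔ i / (t + 1) = k := by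
    intro k i
    rw [Finset.mem_Ico, Nat.div_eq_iff htpos, mul_comm k]
    omega
  have hIn : ∀ k < p + 1, I k ⊆ Finset.range n := by
    intro k hk i hi
    have h1 : (t + 1) * k ≤ (t + 1) * p := Nat.mul_le_mul_left _ (by omega)
    have h2 := Finset.mem_Ico.1 hi
    rw [Finset.mem_range]
    have : (t + 1) * (p + 1) = (t + 1) * p + (t + 1) := by ring
    omega
  have hLn : L ⊆ Finset.range n := fun i hi => Finset.mem_range.2 (Finset.mem_Ico.1 hi).2
  have hmul : (t + 1) * (p + 1) = (t + 1) * p + (t + 1) := by ring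
  have hcover : ∀ i < n, i < (t + 1) * (p + 1) ∨ i ∈ L := by
    intro i hi
    by_cases h : i < (t + 1) * (p + 1)
    · exact Or.inl h
    · exact Or.inr (Finset.mem_Ico.2 ⟨by omega, hi⟩)
  obtain ⟨H, hH⟩ : ∃ H : SimpleGraph V, ∀ a b, H.Adj a b ↔ a ≠ b ∧
      ((∃ k < p + 1, (φ a : ℕ) ∈ I k ∧ (φ b : ℕ) ∈ I k) ∨ ((φ a : ℕ) ∈ L ∧ (φ b : ℕ) ∈ L)) := ⟨
    { Adj := fun a b => a ≠ b ∧ ((∃ k < p + 1, (φ a : ℕ) ∈ I k ∧ (φ b : ℕ) ∈ I k) ∨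
        ((φ a : ℕ) ∈ L ∧ (φ b : ℕ) ∈ L))
      symm := ⟨fun a b h => by
        refine ⟨h.1.symm, ?_⟩
        rcases h.2 with ⟨k, hk, h1, h2⟩ | ⟨h1, h2⟩
        · exact Or.inl ⟨k, hk, h2, h1⟩
        · exact Or.inr ⟨h2, h1⟩⟩
      loopless := ⟨fun a h => h.1 rfl⟩ }, fun _ _ => Iff.rfl⟩
  have hdeg : ∀ (v : V) (S : Finset ℕ), S ⊆ Finset.range n → (φ v : ℕ) ∈ S →
      (∀ w, H.Adj v w → (φ w : ℕ) ∈ S) → degIn H v Finset.univ + 1 ≤ S.card := by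
    intro v S hS hv hw
    rw [← card_filter_index_mem φ hS]
    refine le_trans ?_ (degIn_add_one_le_card H (u := v)
      (U := Finset.univ.filter (fun v => (φ v : ℕ) ∈ S))
      (Finset.mem_filter.2 ⟨Finset.mem_univ _, hv⟩))
    refine Nat.add_le_add_right (Finset.card_le_card ?_) 1
    intro w hw'
    have hw' := (Finset.mem_filter.1 hw').2
    exact Finset.mem_filter.2 ⟨Finset.mem_filter.2 ⟨Finset.mem_univ _, hw w hw'⟩, hw'⟩
  refine ⟨H, ?_, ?_⟩
  · intro v
    rcases hcover (φ v) (φ v).2 with h | h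
    · have hk : (φ v : ℕ) / (t + 1) < p + 1 := (Nat.div_lt_iff_lt_mul htpos).2 (by linarith)
      refine choose_le_triangleDegree_of_clique
        (K := Finset.univ.filter (fun w => (φ w : ℕ) ∈ I ((φ v : ℕ) / (t + 1)))) ?_ ?_ ?_
      · intro a ha b hb hab
        exact (hH a b).2 ⟨hab, Or.inl ⟨_, hk, (Finset.mem_filter.1 ha).2,
          (Finset.mem_filter.1 hb).2⟩⟩
      · rw [card_filter_index_mem φ (hIn _ hk), Nat.card_Ico]
        omega
      · exact Finset.mem_filter.2 ⟨Finset.mem_univ _, (hI _ _).2 rfl⟩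
    · refine choose_le_triangleDegree_of_clique
        (K := Finset.univ.filter (fun w => (φ w : ℕ) ∈ L)) ?_ ?_ ?_
      · intro a ha b hb hab
        exact (hH a b).2 ⟨hab, Or.inr ⟨(Finset.mem_filter.1 ha).2, (Finset.mem_filter.1 hb).2⟩⟩
      · rw [card_filter_index_mem φ hLn, Nat.card_Ico]
        omega
      · exact Finset.mem_filter.2 ⟨Finset.mem_univ _, h⟩
  · -- only the vertices in the overlap of the last two blocks have degree above `t`
    have hOn : Finset.Ico (n - (t + 1)) ((t + 1) * (p + 1)) ⊆ Finset.range n := by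
      intro i hi
      have := Finset.mem_Ico.1 hi
      rw [Finset.mem_range]
      omega
    have hv : ∀ v, degIn H v Finset.univ ≤
        t + if (φ v : ℕ) ∈ Finset.Ico (n - (t + 1)) ((t + 1) * (p + 1)) then r else 0 := by
      intro v
      have hvn := (φ v).2
      by_cases hO : (φ v : ℕ) ∈ Finset.Ico (n - (t + 1)) ((t + 1) * (p + 1))
      · rw [if_pos hO]
        have hO' := Finset.mem_Ico.1 hO
        have h := hdeg v (Finset.Ico ((t + 1) * p) n)
          (fun i hi => Finset.mem_range.2 (Finset.mem_Ico.1 hi).2)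
          (Finset.mem_Ico.2 ⟨by omega, hvn⟩) (by
            intro w hw
            obtain ⟨-, ⟨k, hk, h1, h2⟩ | ⟨h1, h2⟩⟩ := (hH v w).1 hw
            · have hkp : k = p := by
                rw [hI] at h1
                refine le_antisymm (by omega) ?_
                rw [← h1, Nat.le_div_iff_mul_le htpos]
                have : p * (t + 1) = (t + 1) * p := mul_comm _ _
                omega
              subst hkp
              exact Finset.mem_Ico.2 ⟨(Finset.mem_Ico.1 h2).1, (φ w).2⟩
            · exact Finset.mem_Ico.2 ⟨by have := (Finset.mem_Ico.1 h2).1; omega, (φ w).2⟩)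
        rw [Nat.card_Ico] at h
        omega
      · rw [if_neg hO, add_zero]
        rw [Finset.mem_Ico, not_and, not_lt] at hO
        by_cases hL : n - (t + 1) ≤ (φ v : ℕ)
        · have h := hdeg v L hLn (Finset.mem_Ico.2 ⟨hL, hvn⟩) (by
            intro w hw
            obtain ⟨-, ⟨k, hk, h1, h2⟩ | ⟨h1, h2⟩⟩ := (hH v w).1 hw
            · have h3 := hO hL
              have h4 := (Finset.mem_Ico.1 h1).2
              have h5 : (t + 1) * k ≤ (t + 1) * p := Nat.mul_le_mul_left _ (by omega)
              omega
            · exact h2)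
          rw [Nat.card_Ico] at h
          omega
        · have hlt : (φ v : ℕ) < (t + 1) * (p + 1) := by omega
          have hk : (φ v : ℕ) / (t + 1) < p + 1 :=
            (Nat.div_lt_iff_lt_mul htpos).2 (by linarith)
          have h := hdeg v _ (hIn _ hk) ((hI _ _).2 rfl) (by
            intro w hw
            obtain ⟨-, ⟨k, hk, h1, h2⟩ | ⟨h1, h2⟩⟩ := (hH v w).1 hw
            · rw [hI] at h1
              rwa [h1]
            · exact absurd (Finset.mem_Ico.1 h1).1 hL)
          rw [Nat.card_Ico] at h
          omega
    have hsum := Finset.sum_le_sum (fun v (_ : v ∈ (Finset.univ : Finset V)) => hv v)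
    rw [Finset.sum_add_distrib, Finset.sum_const, Finset.card_univ, smul_eq_mul, ← hnV,
      ← Finset.sum_filter, Finset.sum_const, smul_eq_mul, card_filter_index_mem φ hOn,
      Nat.card_Ico] at hsum
    obtain ⟨s, hs⟩ : ∃ s, t + 1 = r + s := ⟨t + 1 - r, by omega⟩
    have h1 : (t + 1) * (p + 1) - (n - (t + 1)) = s := by omega
    rw [h1] at hsum
    have h2 : 4 * (s * r) ≤ (t + 1) ^ 2 := by
      rw [hs]
      have : ((r : ℤ) - s) ^ 2 ≥ 0 := sq_nonneg _
      zify
      nlinarith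
    have h3 : n * t = t * n := mul_comm _ _
    omega

/-! ### Counting vertices -/

section Counting
variable {G : SimpleGraph V} {t : ℕ}

/-- The closed neighbourhood of `u`. -/
noncomputable def closedNbhd (G : SimpleGraph V) (u : V) : Finset V :=
  insert u (Finset.univ.filter (G.Adj u))

theorem mem_closedNbhd {u v : V} : v ∈ closedNbhd G u ↔ v = u ∨ G.Adj u v := by
  simp [closedNbhd]

theorem card_closedNbhd (G : SimpleGraph V) (u : V) :
    (closedNbhd G u).card = degIn G u Finset.univ + 1 := by
  rw [closedNbhd, Finset.card_insert_of_notMem (by simp)]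
  rfl

/-- The vertices of degree exactly `t`. -/
noncomputable def lowVertices (G : SimpleGraph V) (t : ℕ) : Finset V :=
  Finset.univ.filter (fun u => degIn G u Finset.univ = t)

/-- The vertices with two low neighbours whose closed neighbourhoods differ. -/
noncomputable def sharedVertices (G : SimpleGraph V) (t : ℕ) : Finset V :=
  Finset.univ.filter (fun x => ∃ u ∈ lowVertices G t, ∃ w ∈ lowVertices G t,
    G.Adj x u ∧ G.Adj x w ∧ closedNbhd G u ≠ closedNbhd G w)

/-- The low vertices none of whose neighbours is shared. -/
noncomputable def privateVertices (G : SimpleGraph V) (t : ℕ) : Finset V :=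
  (lowVertices G t).filter (fun u => ∀ x ∈ sharedVertices G t, ¬ G.Adj x u)

/-- The closed neighbourhoods of the low vertices without shared neighbours: pairwise disjoint
cliques on `t + 1` vertices if every vertex lies in `t.choose 2` triangles. -/
noncomputable def privateCliques (G : SimpleGraph V) (t : ℕ) : Finset (Finset V) :=
  (privateVertices G t).image (closedNbhd G)

theorem degIn_of_mem_lowVertices {u : V} (hu : u ∈ lowVertices G t) :
    degIn G u Finset.univ = t := (Finset.mem_filter.1 hu).2

/-- A low vertex `y` outside the clique adjacent to `k` in it would make `k` a shared vertex. -/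
theorem le_degIn_of_adj_privateClique (hdeg : ∀ v, t ≤ degIn G v Finset.univ)
    {K : Finset V} (hK : K ∈ privateCliques G t)
    {y k : V} (hy : y ∉ K) (hk : k ∈ K) (hyk : G.Adj y k) : t + 1 ≤ degIn G y Finset.univ := by
  obtain ⟨u, hu, rfl⟩ := Finset.mem_image.1 hK
  obtain ⟨hu, hu'⟩ := Finset.mem_filter.1 hu
  by_contra hlt
  have hyl : y ∈ lowVertices G t := by
    have := hdeg y
    exact Finset.mem_filter.2 ⟨Finset.mem_univ _, by omega⟩
  rcases mem_closedNbhd.1 hk with rfl | huk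
  · exact hy (mem_closedNbhd.2 (Or.inr hyk.symm))
  refine hu' k (Finset.mem_filter.2 ⟨Finset.mem_univ _, u, hu, y, hyl, huk.symm, hyk.symm, ?_⟩)
    huk.symm
  intro h
  rw [h] at hy
  exact hy (mem_closedNbhd.2 (Or.inl rfl))

section Low
variable (hG : TriangleCondition G t)
include hG

theorem adj_of_mem_closedNbhd {u : V} (hu : u ∈ lowVertices G t) :
    ∀ a ∈ closedNbhd G u, ∀ b ∈ closedNbhd G u, a ≠ b → G.Adj a b := by
  intro a ha b hb hab
  rw [mem_closedNbhd] at ha hb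
  rcases ha with rfl | ha
  · rcases hb with rfl | hb
    · exact absurd rfl hab
    · exact hb
  · rcases hb with rfl | hb
    · exact ha.symm
    · exact adj_of_degIn_eq (hG u) (degIn_of_mem_lowVertices hu) ha hb hab

theorem closedNbhd_subset {u x : V} (hu : u ∈ lowVertices G t) (hx : x ∈ closedNbhd G u) :
    closedNbhd G u ⊆ closedNbhd G x := by
  intro a ha
  rw [mem_closedNbhd]
  by_cases h : a = x
  · exact Or.inl h
  · exact Or.inr (adj_of_mem_closedNbhd hG hu x hx a ha (fun h' => h h'.symm))

theorem closedNbhd_eq {u w : V} (hu : u ∈ lowVertices G t) (hw : w ∈ lowVertices G t)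
    (h : w ∈ closedNbhd G u) : closedNbhd G w = closedNbhd G u := by
  refine (Finset.eq_of_subset_of_card_le (closedNbhd_subset hG hu h) ?_).symm
  rw [card_closedNbhd, card_closedNbhd, degIn_of_mem_lowVertices hu, degIn_of_mem_lowVertices hw]

/-- `N[x]` contains the `t + 1` vertices of `N[u]` and the low neighbours of `x` outside `N[u]`. -/
theorem card_low_nbrs_diff_le {x u : V} (hu : u ∈ lowVertices G t) (hxu : G.Adj x u) :
    (((lowVertices G t).filter (G.Adj x)) \ closedNbhd G u).card ≤ degIn G x Finset.univ - t := by
  have h1 : closedNbhd G u ∪ (((lowVertices G t).filter (G.Adj x)) \ closedNbhd G u)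
      ⊆ closedNbhd G x := by
    refine Finset.union_subset (closedNbhd_subset hG hu (mem_closedNbhd.2 (Or.inr hxu.symm))) ?_
    intro a ha
    exact mem_closedNbhd.2 (Or.inr (Finset.mem_filter.1 (Finset.mem_sdiff.1 ha).1).2)
  have h2 := Finset.card_le_card h1
  rw [Finset.card_union_of_disjoint Finset.disjoint_sdiff, card_closedNbhd, card_closedNbhd,
    degIn_of_mem_lowVertices hu] at h2
  omega

/-- Low neighbours `u`, `w` of `x` with different closed neighbourhoods have no low vertex in
`N[u] ∩ N[w]`, so every low neighbour of `x` is missed by `N[u]` or by `N[w]`. -/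
theorem card_low_nbrs_le {x : V} (hx : x ∈ sharedVertices G t) :
    ((lowVertices G t).filter (G.Adj x)).card ≤ 2 * (degIn G x Finset.univ - t) := by
  obtain ⟨-, u, hu, w, hw, hxu, hxw, hne⟩ := Finset.mem_filter.1 hx
  have h1 := card_low_nbrs_diff_le hG hu hxu
  have h2 := card_low_nbrs_diff_le hG hw hxw
  have h3 : (lowVertices G t).filter (G.Adj x) ⊆
      (((lowVertices G t).filter (G.Adj x)) \ closedNbhd G u) ∪
      (((lowVertices G t).filter (G.Adj x)) \ closedNbhd G w) := by
    intro a ha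
    have hal := (Finset.mem_filter.1 ha).1
    rw [Finset.mem_union, Finset.mem_sdiff, Finset.mem_sdiff]
    by_contra hcon
    simp only [ha, true_and, not_or, not_not] at hcon
    exact hne ((closedNbhd_eq hG hu hal hcon.1).symm.trans (closedNbhd_eq hG hw hal hcon.2))
  have h4 := (Finset.card_le_card h3).trans (Finset.card_union_le _ _)
  omega

theorem card_lowVertices_le :
    (lowVertices G t).card ≤ (privateCliques G t).card * (t + 1)
      + 2 * ∑ v, (degIn G v Finset.univ - t) := by
  rw [← Finset.card_filter_add_card_filter_not (s := lowVertices G t)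
    (fun u => ∀ x ∈ sharedVertices G t, ¬ G.Adj x u)]
  refine add_le_add ?_ ?_
  · have h1 : privateVertices G t ⊆ (privateCliques G t).biUnion id := by
      intro u hu
      exact Finset.mem_biUnion.2 ⟨closedNbhd G u, Finset.mem_image_of_mem _ hu,
        mem_closedNbhd.2 (Or.inl rfl)⟩
    refine (Finset.card_le_card h1).trans (Finset.card_biUnion_le_card_mul _ _ _ ?_)
    intro K hK
    obtain ⟨u, hu, rfl⟩ := Finset.mem_image.1 hK
    rw [id, card_closedNbhd, degIn_of_mem_lowVertices (Finset.mem_filter.1 hu).1]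
  · have h1 : (lowVertices G t).filter (fun u => ¬ ∀ x ∈ sharedVertices G t, ¬ G.Adj x u) ⊆
        (sharedVertices G t).biUnion (fun x => (lowVertices G t).filter (G.Adj x)) := by
      intro u hu
      obtain ⟨hu, h⟩ := Finset.mem_filter.1 hu
      push Not at h
      obtain ⟨x, hx, hxu⟩ := h
      exact Finset.mem_biUnion.2 ⟨x, hx, Finset.mem_filter.2 ⟨hu, hxu⟩⟩
    refine (Finset.card_le_card h1).trans (Finset.card_biUnion_le.trans ?_)
    rw [Finset.mul_sum]
    refine (Finset.sum_le_sum fun x hx => card_low_nbrs_le hG hx).trans ?_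
    exact Finset.sum_le_sum_of_subset (Finset.subset_univ _)

theorem disjoint_of_mem_privateCliques {K K' : Finset V} (hK : K ∈ privateCliques G t)
    (hK' : K' ∈ privateCliques G t) (hne : K ≠ K') : Disjoint K K' := by
  obtain ⟨u, hu, rfl⟩ := Finset.mem_image.1 hK
  obtain ⟨w, hw, rfl⟩ := Finset.mem_image.1 hK'
  obtain ⟨hu, hu'⟩ := Finset.mem_filter.1 hu
  obtain ⟨hw, hw'⟩ := Finset.mem_filter.1 hw
  rw [Finset.disjoint_left]
  intro x hxu hxw
  rcases mem_closedNbhd.1 hxu with rfl | hux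
  · exact hne (closedNbhd_eq hG hw hu hxw)
  rcases mem_closedNbhd.1 hxw with rfl | hwx
  · exact hne (closedNbhd_eq hG hu hw hxu).symm
  exact hu' x (Finset.mem_filter.2 ⟨Finset.mem_univ _, u, hu, w, hw, hux.symm, hwx.symm, hne⟩)
    hux.symm

theorem sum_degIn_compl_eq {K : Finset V} (hK : K ∈ privateCliques G t) :
    ∑ y ∈ Kᶜ, degIn G y K = ∑ x ∈ K, (degIn G x Finset.univ - t) := by
  rw [sum_degIn_comm]
  obtain ⟨u, hu, rfl⟩ := Finset.mem_image.1 hK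
  have hu := (Finset.mem_filter.1 hu).1
  refine Finset.sum_congr rfl fun x hx => ?_
  have h1 := degIn_univ_eq G (Finset.disjoint_empty_right (closedNbhd G u)) x
  rw [Finset.union_empty, degIn_clique (adj_of_mem_closedNbhd hG hu) (t := t)
    (by rw [card_closedNbhd, degIn_of_mem_lowVertices hu]) hx] at h1
  have h2 : degIn G x ∅ = 0 := by simp [degIn]
  omega

end Low

/-- Private cliques with few edges leaving them are told apart by the largest number of neighbours
that a vertex outside has in them. -/
theorem injOn_sup_degIn (hG : IsExtremal G t) (hiso : ¬ HasIsolatedClique G (t + 1))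
    (hdeg : ∀ v, t ≤ degIn G v Finset.univ) :
    Set.InjOn (fun K : Finset V => Kᶜ.sup (fun y => degIn G y K))
      {K | K ∈ privateCliques G t ∧ 4 * ∑ x ∈ K, (degIn G x Finset.univ - t) ≤ t} := by
  rintro K ⟨hK, hKs⟩ K' ⟨hK', hKs'⟩ heq
  dsimp only at heq
  by_contra hne
  have hd := disjoint_of_mem_privateCliques hG.1 hK hK' hne
  rw [← sum_degIn_compl_eq hG.1 hK] at hKs
  rw [← sum_degIn_compl_eq hG.1 hK'] at hKs'
  have hcl : ∀ {K : Finset V}, K ∈ privateCliques G t →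
      (∀ a ∈ K, ∀ b ∈ K, a ≠ b → G.Adj a b) ∧ K.card = t + 1 := by
    intro K hK
    obtain ⟨u, hu, rfl⟩ := Finset.mem_image.1 hK
    have hu := (Finset.mem_filter.1 hu).1
    exact ⟨adj_of_mem_closedNbhd hG.1 hu,
      by rw [card_closedNbhd, degIn_of_mem_lowVertices hu]⟩
  have hnon : ∃ u ∈ K, ∃ v ∉ K, G.Adj u v := by
    by_contra hn
    push Not at hn
    refine hiso ⟨K, ⟨?_, (hcl hK).2⟩, hn⟩
    intro a ha b hb hab
    exact (hcl hK).1 a ha b hb hab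
  obtain ⟨u, hu, v, hv, huv⟩ := hnon
  have hpos : 1 ≤ Kᶜ.sup (fun y => degIn G y K) := by
    refine le_trans ?_ (Finset.le_sup (f := fun y => degIn G y K) (Finset.mem_compl.2 hv))
    exact Finset.card_pos.2 ⟨u, Finset.mem_filter.2 ⟨hu, huv.symm⟩⟩
  have hatt : ∀ K : Finset V, 1 ≤ Kᶜ.sup (fun y => degIn G y K) →
      ∃ y ∉ K, degIn G y K = Kᶜ.sup (fun y => degIn G y K) := by
    intro K h
    have hne : Kᶜ.Nonempty := by
      rw [Finset.nonempty_iff_ne_empty]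
      intro h0
      rw [h0] at h
      simp at h
    obtain ⟨y, hy, hy'⟩ := Finset.exists_mem_eq_sup Kᶜ hne (fun y => degIn G y K)
    exact ⟨y, Finset.mem_compl.1 hy, hy'.symm⟩
  refine false_of_same_height hd (hcl hK).1 (hcl hK).2 (hcl hK').1 (hcl hK').2 hG ?_ ?_ hpos
    (fun y hy => Finset.le_sup (f := fun y => degIn G y K) (Finset.mem_compl.2 hy))
    (fun y hy => by
      rw [heq]
      exact Finset.le_sup (f := fun y => degIn G y K') (Finset.mem_compl.2 hy))
    (hatt K hpos) (by rw [heq]; exact hatt K' (heq ▸ hpos))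
  · rintro y hy ⟨k, hk, hyk⟩
    rw [Finset.mem_union, not_or] at hy
    rcases Finset.mem_union.1 hk with hk | hk
    · exact le_degIn_of_adj_privateClique hdeg hK hy.1 hk hyk
    · exact le_degIn_of_adj_privateClique hdeg hK' hy.2 hk hyk
  · rw [Finset.sum_add_distrib]
    have h1 : ∑ y ∈ (K ∪ K')ᶜ, degIn G y K ≤ ∑ y ∈ Kᶜ, degIn G y K :=
      Finset.sum_le_sum_of_subset (Finset.compl_subset_compl.2 Finset.subset_union_left)
    have h2 : ∑ y ∈ (K ∪ K')ᶜ, degIn G y K' ≤ ∑ y ∈ K'ᶜ, degIn G y K' :=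
      Finset.sum_le_sum_of_subset (Finset.compl_subset_compl.2 Finset.subset_union_right)
    omega

theorem sum_excess_le (hG : IsExtremal G t) (hdeg : ∀ v, t ≤ degIn G v Finset.univ)
    (hn : t + 1 ≤ Fintype.card V) :
    4 * ∑ v, (degIn G v Finset.univ - t) ≤ (t + 1) ^ 2 := by
  obtain ⟨H, hH, hHd⟩ := exists_blocks_graph t hn
  have h1 := hG.2 H hH
  have h2 := two_mul_edges_eq_sum_degIn G
  have h3 := two_mul_edges_eq_sum_degIn H
  have h4 : ∑ v, (degIn G v Finset.univ - t) + t * Fintype.card V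
      = ∑ v, degIn G v Finset.univ := by
    rw [← Finset.card_univ, mul_comm, ← smul_eq_mul, ← Finset.sum_const, ← Finset.sum_add_distrib]
    exact Finset.sum_congr rfl fun v _ => Nat.sub_add_cancel (hdeg v)
  omega

/-- At most `t + 1` private cliques have more than `t / 4` leaving edges, by the bound on the total
excess degree, and the others are counted by `injOn_sup_degIn`. -/
theorem card_privateCliques_le (hG : IsExtremal G t) (hiso : ¬ HasIsolatedClique G (t + 1))
    (hdeg : ∀ v, t ≤ degIn G v Finset.univ) (hn : t + 1 ≤ Fintype.card V) :
    (privateCliques G t).card ≤ 2 * (t + 1) := by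
  rw [← Finset.card_filter_add_card_filter_not (s := privateCliques G t)
    (fun K => 4 * ∑ x ∈ K, (degIn G x Finset.univ - t) ≤ t), two_mul]
  refine add_le_add ?_ ?_
  · rw [← Finset.card_range (t + 1)]
    refine Finset.card_le_card_of_injOn (fun K : Finset V => Kᶜ.sup (fun y => degIn G y K)) ?_ ?_
    · intro K hK
      obtain ⟨hK, hKs⟩ := Finset.mem_filter.1 hK
      rw [Finset.coe_range, Set.mem_Iio, Nat.lt_succ_iff, Finset.sup_le_iff]
      intro y hy
      rw [← sum_degIn_compl_eq hG.1 hK] at hKs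
      have := Finset.single_le_sum (f := fun y => degIn G y K) (fun _ _ => Nat.zero_le _) hy
      omega
    · intro K hK K' hK' h
      exact injOn_sup_degIn hG hiso hdeg (Finset.mem_filter.1 hK) (Finset.mem_filter.1 hK') h
  · have hE := sum_excess_le hG hdeg hn
    set B := (privateCliques G t).filter
      (fun K => ¬ 4 * ∑ x ∈ K, (degIn G x Finset.univ - t) ≤ t) with hB
    have h1 : B.card * (t + 1) ≤ ∑ K ∈ B, 4 * ∑ x ∈ K, (degIn G x Finset.univ - t) := by
      rw [← smul_eq_mul]
      refine Finset.card_nsmul_le_sum _ _ _ fun K hK => ?_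
      have := (Finset.mem_filter.1 hK).2
      omega
    have h2 : ∑ K ∈ B, ∑ x ∈ K, (degIn G x Finset.univ - t)
        ≤ ∑ v, (degIn G v Finset.univ - t) := by
      have h3 := Finset.sum_biUnion (s := B) (t := id)
        (f := fun x => degIn G x Finset.univ - t) (by
          intro K hK K' hK' hne
          exact disjoint_of_mem_privateCliques hG.1 (Finset.mem_filter.1 hK).1
            (Finset.mem_filter.1 hK').1 hne)
      simp only [id] at h3
      rw [← h3]
      exact Finset.sum_le_sum_of_subset (Finset.subset_univ _)
    rw [← Finset.mul_sum] at h1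
    have h3 : B.card * (t + 1) ≤ (t + 1) * (t + 1) := by
      rw [← sq (t + 1)]
      omega
    exact Nat.le_of_mul_le_mul_right h3 (Nat.succ_pos t)

theorem card_le_of_not_hasIsolatedClique (hG : IsExtremal G t) (ht : 2 ≤ t)
    (hiso : ¬ HasIsolatedClique G (t + 1)) (hn : t + 1 ≤ Fintype.card V) :
    4 * Fintype.card V ≤ 11 * (t + 1) ^ 2 := by
  have hdeg : ∀ v, t ≤ degIn G v Finset.univ := fun v => le_degIn_of_choose_le ht (hG.1 v)
  have hE := sum_excess_le hG hdeg hn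
  have hK := card_privateCliques_le hG hiso hdeg hn
  have hL := card_lowVertices_le hG.1
  have hsplit := Finset.card_filter_add_card_filter_not (s := (Finset.univ : Finset V))
    (fun u => degIn G u Finset.univ = t)
  have hhigh : (Finset.univ.filter (fun u => ¬ degIn G u Finset.univ = t)).card
      ≤ ∑ v, (degIn G v Finset.univ - t) := by
    rw [Finset.card_filter]
    refine Finset.sum_le_sum fun v _ => ?_
    have := hdeg v
    split_ifs <;> omega
  rw [Finset.card_univ] at hsplit
  change (lowVertices G t).card + _ = _ at hsplit
  have hK' := Nat.mul_le_mul_right (t + 1) hK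
  have : 2 * (t + 1) * (t + 1) = 2 * (t + 1) ^ 2 := by ring
  omega

end Counting

end
end MinDegKruskalKatona

theorem theorem3 :
    ∃ f : ℕ → ℝ, f =o[atTop] (fun t : ℕ => (t : ℝ) ^ 2) ∧
      ∃ T : ℕ, ∀ t : ℕ, T ≤ t →
        ∀ (V : Type*) [Fintype V] (G : SimpleGraph V),
          (1 + Real.sqrt (928 / 33)) * (t : ℝ) ^ 2 + f t ≤ (Fintype.card V : ℝ) →
          MinDegKruskalKatona.IsExtremal G t →
          MinDegKruskalKatona.HasIsolatedClique G (t + 1) := by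
  refine ⟨fun _ => 0, isLittleO_zero _ _, 3, ?_⟩
  intro t ht V _ G hV hG
  by_contra hiso
  have hsqrt : (5 : ℝ) ≤ Real.sqrt (928 / 33) := Real.le_sqrt_of_sq_le (by norm_num)
  have h6 : 6 * t ^ 2 ≤ Fintype.card V := by
    have : (6 : ℝ) * (t : ℝ) ^ 2 ≤ (Fintype.card V : ℝ) := by nlinarith [sq_nonneg (t : ℝ)]
    exact_mod_cast this
  have hn : t + 1 ≤ Fintype.card V := by nlinarith
  have := MinDegKruskalKatona.card_le_of_not_hasIsolatedClique hG (by omega) hiso hn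
  nlinarith
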